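/- Let $n\ge 1$, $\alpha\ge 0$ and $\Gamma_\alpha=\{\lambda\in\mathbb R^n:\lambda_k>\alpha \text{ for all } k\}$. Let $f:\Gamma_\alpha\to\mathbb R$ be smooth, symmetric (invariant under permutations of the arguments), monotone (nondecreasing in each argument), concave and inverse-concave. The last condition means that for some $\sigma\in[0,\alpha]$ the function $\kappa\mapsto -f(\sigma+\kappa_1^{-1},\dots,\sigma+\kappa_n^{-1})$ is concave on the set of all $\kappa$ with $\kappa_i>0$ and $\sigma+\kappa_i^{-1}>\alpha$ for all $i$. (For $\sigma=0$ this is inverse concavity of $f$ itself; for $\sigma=\alpha$ it is inverse concavity of $\tilde f$ on the positive cone, where $f(\lambda)=\tilde f(\lambda_1-\alpha,\dots,\lambda_n-\alpha)$.) For a symmetric real $n\times n$ matrix $A$ with eigenvalues $\lambda(A)\in\Gamma_\alpha$ put $F(A)=f(\lambda(A))$, and let $F^{kl}(A)$ and $F^{kl,pq}(A)$ be the components of the first and second derivatives of $F$ on the space of symmetric matrices, i.e. $DF(A)[B]=F^{kl}(A)B_{kl}$ and $D^2F(A)[B,C]=F^{kl,pq}(A)B_{kl}C_{pq}$ for symmetric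 $B,C$, with $F^{kl}$ symmetric in $(k,l)$ and $F^{kl,pq}$ symmetric in $(k,l)$ and in $(p,q)$. Repeated indices are summed from $1$ to $n$, and indices are raised and lowered with $\delta_{ij}$. Let $A$ be a symmetric matrix with eigenvalues in $\Gamma_\alpha$ and $v\neq 0$ an eigenvector of $A$ for its smallest eigenvalue. Let $\tilde A=A-\alpha I$ and $$\epsilon=\frac{\tilde A_{ij}v^iv^j}{\operatorname{tr}\tilde A\,|v|^2}.$$ Then $\epsilon\in(0,\tfrac1n]$, and $\epsilon=\tfrac1n$ only if $A$ is a multiple of the identity. If $T$ is a totally symmetric $3$-tensor with $T_{ijk}v^iv^j=\epsilon\,\delta^{ij}T_{ijk}$ for $k=1,\dots,n$, then $$\begin{aligned}\beta:={}&v^iv^jF^{kl,pq}(A)T_{ikl}T_{jpq}-\epsilon|v|^2\delta^{ab}F^{kl,pq}(A)T_{akl}T_{bpq}\\&+2\sup_{\Gamma}F^{kl}(A)\Big(2\Gamma^p_k\big(T_{lpi}v^i-\epsilon\,\delta^{ab}T_{lab}v_p\big)-\Gamma^p_k\Gamma^q_l\big(\tilde A_{pq}-\epsilon\operatorname{tr}\tilde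 A\,\delta_{pq}\big)\Big)\ \ge 0,\end{aligned}$$ where the supremum is over all real arrays $(\Gamma^p_k)_{1\le k,p\le n}$ and takes values in $(-\infty,+\infty]$. -/

import Mathlib

open scoped ContDiff Matrix

/- The entrywise sup norm on matrices; it is only used to speak of derivatives on the
finite-dimensional space of symmetric matrices, where the choice of the norm is immaterial. -/
attribute [local instance] Matrix.normedAddCommGroup Matrix.normedSpace

noncomputable section

namespace CurvaturePinching

/-- `Γ_α`: the vectors all of whose components are larger than `α`. -/
def Gam (n : ℕ) (α : ℝ) : Set (Fin n → ℝ) := {κ | ∀ i, α < κ i}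

/-- `f` is invariant under permutations of its arguments on `Γ_α`. -/
def SymmetricOn {n : ℕ} (α : ℝ) (f : (Fin n → ℝ) → ℝ) : Prop :=
  ∀ κ ∈ Gam n α, ∀ π : Equiv.Perm (Fin n), f (κ ∘ π) = f κ

/-- Inverse concavity of a function `f` on `Γ_α`, with respect to the base point `σ`:
the function `κ ↦ -f(σ + 1/κ₁, …, σ + 1/κₙ)` is concave, on all the positive `κ` for which the
argument of `f` lies in `Γ_α`. For `σ = 0` this is inverse concavity of `f` itself; in general it is
inverse concavity of `g`, where `f (κ) = g (κ - σ e)` and `e = (1, …, 1)`. -/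
def InverseConcaveOn {n : ℕ} (α σ : ℝ) (f : (Fin n → ℝ) → ℝ) : Prop :=
  ConcaveOn ℝ {κ : Fin n → ℝ | (∀ i, 0 < κ i) ∧ (fun i => σ + (κ i)⁻¹) ∈ Gam n α}
    (fun κ => -f (fun i => σ + (κ i)⁻¹))

/-- The space of symmetric real `n × n` matrices. -/
def SymMat (n : ℕ) : Submodule ℝ (Matrix (Fin n) (Fin n) ℝ) where
  carrier := {A | Aᵀ = A}
  add_mem' := by
    intro A B hA hB
    simp only [Set.mem_ofPred_eq] at hA hB ⊢
    rw [Matrix.transpose_add, hA, hB]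
  zero_mem' := Matrix.transpose_zero
  smul_mem' := by
    intro c A hA
    simp only [Set.mem_ofPred_eq] at hA ⊢
    rw [Matrix.transpose_smul, hA]

theorem SymMat.isHermitian {n : ℕ} (A : SymMat n) :
    (A : Matrix (Fin n) (Fin n) ℝ).IsHermitian := by
  have h : (A : Matrix (Fin n) (Fin n) ℝ)ᵀ = A := A.2
  rw [Matrix.IsHermitian, Matrix.conjTranspose_eq_transpose_of_trivial, h]

/-- The eigenvalues of a symmetric matrix, with multiplicity. -/
def eig {n : ℕ} (A : SymMat n) : Fin n → ℝ := (SymMat.isHermitian A).eigenvalues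

/-- The curvature function `f`, as a function `F` of symmetric matrices. -/
def matFun {n : ℕ} (f : (Fin n → ℝ) → ℝ) (A : SymMat n) : ℝ := f (eig A)

/-- The symmetric matrix `(E_kl + E_lk) / 2`. -/
def symUnit {n : ℕ} (k l : Fin n) : SymMat n :=
  ⟨(1 / 2 : ℝ) • (Matrix.single k l 1 + Matrix.single l k 1), by
    change ((1 / 2 : ℝ) • (Matrix.single k l (1 : ℝ) + Matrix.single l k 1))ᵀ = _
    rw [Matrix.transpose_smul, Matrix.transpose_add, Matrix.transpose_single,
      Matrix.transpose_single, add_comm]⟩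

/-- `F^{kl}(A)`: the components of the first derivative of `F` on the symmetric matrices, so that
`dF(A)[B] = ∑ F^{kl}(A) B_kl` for symmetric `B`, and `F^{kl} = F^{lk}`. -/
def F1 {n : ℕ} (f : (Fin n → ℝ) → ℝ) (A : SymMat n) (k l : Fin n) : ℝ :=
  fderiv ℝ (matFun f) A (symUnit k l)

/-- `F^{kl,pq}(A)`: the components of the second derivative of `F` on the symmetric matrices. -/
def F2 {n : ℕ} (f : (Fin n → ℝ) → ℝ) (A : SymMat n) (k l p q : Fin n) : ℝ :=
  fderiv ℝ (fun X : SymMat n => fderiv ℝ (matFun f) X) A (symUnit k l) (symUnit p q)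

/-- `v` is an eigenvector of `A` for the smallest eigenvalue of `A`. -/
def IsMinEigenvector {n : ℕ} (A : SymMat n) (v : Fin n → ℝ) : Prop :=
  v ≠ 0 ∧ ∃ μ : ℝ, (A : Matrix (Fin n) (Fin n) ℝ) *ᵥ v = μ • v ∧ ∀ i, μ ≤ eig A i

/-- `Ã = A - α I`. -/
def shifted {n : ℕ} (α : ℝ) (A : SymMat n) : Matrix (Fin n) (Fin n) ℝ :=
  (A : Matrix (Fin n) (Fin n) ℝ) - α • (1 : Matrix (Fin n) (Fin n) ℝ)

/-- `ε = Ã_ij vⁱ vʲ / (tr Ã |v|²)`. -/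
def eps {n : ℕ} (α : ℝ) (A : SymMat n) (v : Fin n → ℝ) : ℝ :=
  (∑ i, ∑ j, shifted α A i j * v i * v j) / ((shifted α A).trace * ∑ i, v i ^ 2)

/-- `T` is a totally symmetric 3-tensor. -/
def TotallySymmetric {n : ℕ} (T : Fin n → Fin n → Fin n → ℝ) : Prop :=
  ∀ i j k, T i j k = T j i k ∧ T i j k = T i k j

/-- The expression
`F^{kl}(A) (2 Γᵖ_k (T_lpi vⁱ - ε δ^{ab} T_lab v_p) - Γᵖ_k Γ^q_l (Ã_pq - ε tr Ã δ_pq))`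
under the supremum; `G p k` is `Γᵖ_k`. -/
def gammaTerm {n : ℕ} (α : ℝ) (f : (Fin n → ℝ) → ℝ) (A : SymMat n) (v : Fin n → ℝ)
    (T : Fin n → Fin n → Fin n → ℝ) (G : Fin n → Fin n → ℝ) : ℝ :=
  ∑ k, ∑ l, F1 f A k l *
    (2 * (∑ p, G p k * ((∑ i, T l p i * v i) - eps α A v * (∑ a, T l a a) * v p))
      - ∑ p, ∑ q, G p k * G q l *
          (shifted α A p q
            - eps α A v * (shifted α A).trace * (1 : Matrix (Fin n) (Fin n) ℝ) p q))

/-- The quantity `β`. The supremum runs over all real arrays `Γᵖ_k` and can be `+∞`, so it is taken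
in the extended reals. -/
def beta {n : ℕ} (α : ℝ) (f : (Fin n → ℝ) → ℝ) (A : SymMat n) (v : Fin n → ℝ)
    (T : Fin n → Fin n → Fin n → ℝ) : EReal :=
  (((∑ i, ∑ j, ∑ k, ∑ l, ∑ p, ∑ q, v i * v j * F2 f A k l p q * T i k l * T j p q)
      - eps α A v * (∑ i, v i ^ 2) *
          (∑ a, ∑ k, ∑ l, ∑ p, ∑ q, F2 f A k l p q * T a k l * T a p q) : ℝ) : EReal)
    + 2 * ⨆ G : Fin n → Fin n → ℝ, ((gammaTerm α f A v T G : ℝ) : EReal)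

end CurvaturePinching

end

/-! In an orthonormal eigenbasis of `A` with eigenvalues `λ`, the second derivative of `F` is
`∑ ∂_k∂_l f B_kk B_ll + ∑_{k ≠ l} c_kl B_kl²`, where `c_kl` are the divided differences of the
gradient of `f`. Concavity gives `∂²f ≤ 0` and `c_kl ≤ 0`; inverse concavity bounds both below, by
`∂²f ≥ -2 diag (∂_k f / x_k)` and `c_kl ≥ -(∂_k f / x_l + ∂_l f / x_k)` with `x = λ - σ`, and the
bounds only become weaker for `x = λ - α`. Take `v` to be the basis vector `o`. The quadratic part
of the expression in `Γ` is diagonal with entries `x_a - x_o ≥ 0`. If its kernel meets the linear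
part, the supremum is infinite or `∂f` has a zero, in which case `∂f` and `D²F` vanish. Otherwise
complete the square in `Γ`: after dropping all but the entries `(o, a)` and `(a, o)` from the slices
`T_a`, `a ≠ o`, only `b = T_o` remains, with `b_oo = ε tr b`, and the Cauchy–Schwarz inequality
bounds `b_oo²` by the other diagonal entries.

The second derivative of `F` is computed without differentiating eigenvalues: for polynomials in a
matrix it is explicit, and the gradient of `F` agrees to first order at `A` with a combination of
such polynomials and their traces, by the Hoffman–Wielandt inequality. -/

noncomputable section

namespace CurvaturePinching

open Filter Topology Polynomial Asymptotics

/-! ### Concave functions and their derivatives -/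

section Concave

variable {E : Type*} [NormedAddCommGroup E] [NormedSpace ℝ E] {s : Set E} {f : E → ℝ}

theorem hasDerivAt_add_smul (x y : E) : HasDerivAt (fun t : ℝ => x + t • y) y 0 := by
  simpa using ((hasDerivAt_id (0 : ℝ)).smul_const y).const_add x

theorem le_add_of_concaveOn_of_hasFDerivAt {f' : E →L[ℝ] ℝ} {x y : E} (hf : ConcaveOn ℝ s f)
    (hx : x ∈ s) (hy : y ∈ s) (h : HasFDerivAt f f' x) : f y ≤ f x + f' (y - x) := by
  have hline : HasDerivAt (f ∘ AffineMap.lineMap x y) (f' (y - x)) (0 : ℝ) :=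
    h.comp_hasDerivAt_of_eq 0 AffineMap.hasDerivAt_lineMap (by simp)
  have hslope := (hf.comp_affineMap (AffineMap.lineMap x y)).slope_le_of_hasDerivAt
    (x := (0 : ℝ)) (y := 1) (by simpa using hx) (by simpa using hy) one_pos hline
  simp only [slope, Function.comp_apply, AffineMap.lineMap_apply_one, AffineMap.lineMap_apply_zero,
    sub_zero, inv_one, one_smul, vsub_eq_sub] at hslope
  linarith

theorem sub_apply_sub_nonpos_of_concaveOn {f' g' : E →L[ℝ] ℝ} {x y : E} (hf : ConcaveOn ℝ s f)
    (hx : x ∈ s) (hy : y ∈ s) (h : HasFDerivAt f f' x) (hg : HasFDerivAt f g' y) :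
    (g' - f') (y - x) ≤ 0 := by
  have h1 := le_add_of_concaveOn_of_hasFDerivAt hf hx hy h
  have h2 := le_add_of_concaveOn_of_hasFDerivAt hf hy hx hg
  rw [← neg_sub y x, map_neg] at h2
  rw [sub_apply]
  linarith

/-- Differentiating the monotonicity of the gradient along a curve, and not only along a line,
keeps the reparametrisation `κ ↦ 1 / κ` out of the second derivatives. -/
theorem deriv_fderiv_apply_deriv_nonpos_of_concaveOn {γ : ℝ → E} {γ' : E} {L : ℝ → E →L[ℝ] ℝ}
    {L' : E →L[ℝ] ℝ} (hf : ConcaveOn ℝ s f) (hγ : HasDerivAt γ γ' 0) (hL : HasDerivAt L L' 0)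
    (hγs : ∀ᶠ t in 𝓝 0, γ t ∈ s) (hfL : ∀ᶠ t in 𝓝 0, HasFDerivAt f (L t) (γ t)) : L' γ' ≤ 0 := by
  have hlim := (isBoundedBilinearMap_apply.continuous.tendsto (L', γ')).comp
    ((hasDerivAt_iff_tendsto_slope.1 hL).prodMk_nhds (hasDerivAt_iff_tendsto_slope.1 hγ))
  refine le_of_tendsto hlim ?_
  filter_upwards [hγs.filter_mono nhdsWithin_le_nhds, hfL.filter_mono nhdsWithin_le_nhds]
    with t hts hft
  have h := sub_apply_sub_nonpos_of_concaveOn hf hγs.self_of_nhds hts hfL.self_of_nhds hft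
  simp only [Function.comp_apply, slope, sub_zero, vsub_eq_sub, smul_apply, map_smul, smul_eq_mul,
    ← mul_assoc]
  exact mul_nonpos_of_nonneg_of_nonpos (mul_self_nonneg _) h

end Concave

/-! ### Partial derivatives -/

section PartialDerivatives

/-- The functional `η ↦ ∑ i, w i * η i`, depending linearly on `w`. -/
def covector {ι : Type*} [Fintype ι] : (ι → ℝ) →L[ℝ] (ι → ℝ) →L[ℝ] ℝ :=
  ∑ i, (ContinuousLinearMap.proj (φ := fun _ : ι => ℝ) i).smulRight
    (ContinuousLinearMap.proj (R := ℝ) (φ := fun _ : ι => ℝ) i)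

@[simp]
theorem covector_apply {ι : Type*} [Fintype ι] (w η : ι → ℝ) :
    covector w η = ∑ i, w i * η i := by
  simp [covector, sum_apply]

variable {ι : Type*} [DecidableEq ι] {f : (ι → ℝ) → ℝ} {κ : ι → ℝ}

/-- The vector of first partial derivatives. -/
def grad (f : (ι → ℝ) → ℝ) (κ : ι → ℝ) (i : ι) : ℝ :=
  fderiv ℝ f κ (Pi.single i 1)

/-- The array of second partial derivatives; `hess f κ i j` differentiates along `i` first. -/
def hess (f : (ι → ℝ) → ℝ) (κ : ι → ℝ) (i j : ι) : ℝ :=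
  grad (fun x => grad f x i) κ j

theorem grad_congr {g : (ι → ℝ) → ℝ} (h : f =ᶠ[𝓝 κ] g) : grad f κ = grad g κ := by
  unfold grad; rw [h.fderiv_eq]

theorem grad_comp_perm [Finite ι] (f : (ι → ℝ) → ℝ) (κ : ι → ℝ) (π : Equiv.Perm ι) (i : ι) :
    grad (fun x => f (x ∘ π)) κ (π i) = grad f (κ ∘ π) i := by
  cases nonempty_fintype ι
  have h := (LinearEquiv.funCongrLeft ℝ ℝ π).toContinuousLinearEquiv.comp_right_fderiv
    (f := f) (x := κ)
  have h' := DFunLike.congr_fun h (Pi.single (π i) 1)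
  have e' : (Pi.single (π i) 1 : ι → ℝ) ∘ π = Pi.single i 1 := by
    ext k; simp [Pi.single_apply]
  rw [grad, grad, ← e']
  exact h'

variable [Fintype ι]

theorem hasFDerivAt_covector_grad (hf : DifferentiableAt ℝ f κ) :
    HasFDerivAt f (covector (grad f κ)) κ := by
  refine hf.hasFDerivAt.congr_fderiv (ContinuousLinearMap.ext fun η => ?_)
  conv_lhs => rw [← Finset.univ_sum_single η, map_sum]
  rw [covector_apply]
  refine Finset.sum_congr rfl fun i _ => ?_
  rw [grad, mul_comm, ← smul_eq_mul, ← map_smul, ← Pi.single_smul, smul_eq_mul, mul_one]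

theorem differentiableAt_grad (hf : ContDiffAt ℝ 2 f κ) (i : ι) :
    DifferentiableAt ℝ (fun x => grad f x i) κ :=
  ((hf.fderiv_right (m := 1) (by norm_cast)).differentiableAt one_ne_zero).clm_apply
    (differentiableAt_const _)

theorem hasFDerivAt_grad (hf : ContDiffAt ℝ 2 f κ) (i : ι) :
    HasFDerivAt (fun x => grad f x i) (covector (hess f κ i)) κ :=
  hasFDerivAt_covector_grad (differentiableAt_grad hf i)

theorem hasDerivAt_grad_add_smul (hf : ContDiffAt ℝ 2 f κ) (η : ι → ℝ) (i : ι) :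
    HasDerivAt (fun t : ℝ => grad f (κ + t • η) i) (∑ j, hess f κ i j * η j) 0 := by
  rw [← covector_apply]
  exact (hasFDerivAt_grad hf i).comp_hasDerivAt_of_eq 0 (hasDerivAt_add_smul κ η) (by simp)

theorem hess_comm (hf : ContDiffAt ℝ 2 f κ) (i j : ι) : hess f κ i j = hess f κ j i := by
  have h2 : ∀ a b : ι, hess f κ a b =
      fderiv ℝ (fderiv ℝ f) κ (Pi.single b 1) (Pi.single a 1) := fun a b => by
    have hd := (hf.fderiv_right (m := 1) (by norm_cast)).differentiableAt one_ne_zero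
    simp only [hess, grad]
    rw [fderiv_clm_apply hd (differentiableAt_const _)]
    simp
  rw [h2, h2]
  exact (hf.isSymmSndFDerivAt (by simp)).eq _ _

theorem grad_sub_grad_mul_sub_nonpos {s : Set (ι → ℝ)} {w : ι → ℝ} {k l : ι}
    (hc : ConcaveOn ℝ s f) (hκ : κ ∈ s) (hκ' : κ ∘ Equiv.swap k l ∈ s)
    (hsymm : f (κ ∘ Equiv.swap k l) = f κ) (hw : HasFDerivAt f (covector w) κ) :
    (w k - w l) * (κ k - κ l) ≤ 0 := by
  have h := le_add_of_concaveOn_of_hasFDerivAt hc hκ hκ' hw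
  have e : κ ∘ Equiv.swap k l - κ =
      (κ l - κ k) • (Pi.single k 1 - Pi.single l 1 : ι → ℝ) := by
    ext i
    by_cases hk : i = k <;> by_cases hl : i = l <;>
      simp [Equiv.swap_apply_def, hk, hl, Pi.single_apply] <;> aesop
  rw [e, map_smul, map_sub, hsymm] at h
  simp only [covector_apply, Pi.single_apply, mul_ite, mul_one, mul_zero, Finset.sum_ite_eq',
    Finset.mem_univ, if_true, smul_eq_mul] at h
  linarith

end PartialDerivatives

/-! ### Symmetric functions on `Γ_α` -/

section Symmetric

variable {n : ℕ} {α σ : ℝ} {f : (Fin n → ℝ) → ℝ} {κ : Fin n → ℝ}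

theorem Gam_mem_nhds (hκ : κ ∈ Gam n α) : Gam n α ∈ 𝓝 κ := by
  have h : IsOpen (Gam n α) := by
    simp only [Gam, Set.ofPred_forall]
    exact isOpen_iInter_of_finite fun i => isOpen_lt continuous_const (continuous_apply i)
  exact h.mem_nhds hκ

theorem comp_perm_mem_Gam (hκ : κ ∈ Gam n α) (π : Equiv.Perm (Fin n)) : κ ∘ π ∈ Gam n α :=
  fun i => hκ (π i)

theorem SymmetricOn.grad_comp_perm (hs : SymmetricOn α f) (hκ : κ ∈ Gam n α)
    (π : Equiv.Perm (Fin n)) (i : Fin n) : grad f (κ ∘ π) i = grad f κ (π i) := by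
  rw [← CurvaturePinching.grad_comp_perm]
  refine congrFun (grad_congr ?_) _
  filter_upwards [Gam_mem_nhds hκ] with x hx using hs x hx π

theorem SymmetricOn.hess_comp_perm (hs : SymmetricOn α f) (hκ : κ ∈ Gam n α)
    (π : Equiv.Perm (Fin n)) (i j : Fin n) : hess f (κ ∘ π) i j = hess f κ (π i) (π j) := by
  rw [hess, ← CurvaturePinching.grad_comp_perm]
  refine congrFun (grad_congr ?_) _
  filter_upwards [Gam_mem_nhds hκ] with x hx using hs.grad_comp_perm hx π i

theorem comp_swap_of_eq {ι β : Type*} [DecidableEq ι] {κ : ι → β} {i j : ι} (h : κ i = κ j) :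
    κ ∘ Equiv.swap i j = κ := by
  ext k
  simp only [Function.comp_apply, Equiv.swap_apply_def]
  split_ifs with h1 h2
  · rw [h1, h]
  · rw [h2, h]
  · rfl

theorem SymmetricOn.grad_eq_of_eq (hs : SymmetricOn α f) (hκ : κ ∈ Gam n α) {i j : Fin n}
    (h : κ i = κ j) : grad f κ i = grad f κ j := by
  have := hs.grad_comp_perm hκ (Equiv.swap i j) i
  rwa [comp_swap_of_eq h, Equiv.swap_apply_left] at this

theorem SymmetricOn.hess_diag_eq_of_eq (hs : SymmetricOn α f) (hκ : κ ∈ Gam n α) {i j : Fin n}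
    (h : κ i = κ j) : hess f κ i i = hess f κ j j := by
  have := hs.hess_comp_perm hκ (Equiv.swap i j) i i
  rwa [comp_swap_of_eq h, Equiv.swap_apply_left] at this

theorem SymmetricOn.hess_left_eq_of_eq (hs : SymmetricOn α f) (hκ : κ ∈ Gam n α)
    {i i' j : Fin n} (h : κ i = κ i') (hi : j ≠ i) (hi' : j ≠ i') :
    hess f κ i j = hess f κ i' j := by
  have := hs.hess_comp_perm hκ (Equiv.swap i i') i j
  rwa [comp_swap_of_eq h, Equiv.swap_apply_left, Equiv.swap_apply_of_ne_of_ne hi hi'] at this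

theorem SymmetricOn.hess_offDiag_eq_of_eq (hs : SymmetricOn α f) (hf : ContDiffOn ℝ 2 f (Gam n α))
    (hκ : κ ∈ Gam n α) {i i' j j' : Fin n} (hi : κ i = κ i') (hj : κ j = κ j') (hij : i ≠ j)
    (hij' : i' ≠ j') : hess f κ i j = hess f κ i' j' := by
  have hcomm := hess_comm (hf.contDiffAt (Gam_mem_nhds hκ))
  have hright : ∀ {a b b' : Fin n}, κ b = κ b' → a ≠ b → a ≠ b' → hess f κ a b = hess f κ a b' :=
    fun {a b b'} hb h1 h2 => by
      rw [hcomm a b, hcomm a b', hs.hess_left_eq_of_eq hκ hb h1 h2]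
  by_cases h1 : i' = j
  · by_cases h2 : j' = i
    · rw [h1, h2, hcomm]
    · rw [hright hj hij (Ne.symm h2), hs.hess_left_eq_of_eq hκ hi h2 hij'.symm]
  · rw [hs.hess_left_eq_of_eq hκ hi hij.symm (Ne.symm h1), hright hj h1 hij']

theorem hess_quadratic_nonpos (hf : ContDiffOn ℝ 2 f (Gam n α)) (hc : ConcaveOn ℝ (Gam n α) f)
    (hκ : κ ∈ Gam n α) (η : Fin n → ℝ) : ∑ k, ∑ l, hess f κ k l * η k * η l ≤ 0 := by
  have hline := hasDerivAt_add_smul κ η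
  have hmem : ∀ᶠ t : ℝ in 𝓝 0, κ + t • η ∈ Gam n α :=
    hline.continuousAt.eventually_mem (by simpa using Gam_mem_nhds hκ)
  have h := deriv_fderiv_apply_deriv_nonpos_of_concaveOn hc hline
    (covector.hasFDerivAt.comp_hasDerivAt 0 (hasDerivAt_pi.2 fun i =>
      hasDerivAt_grad_add_smul (hf.contDiffAt (Gam_mem_nhds hκ)) η i)) hmem
    (hmem.mono fun t ht => hasFDerivAt_covector_grad
      ((hf.contDiffAt (Gam_mem_nhds ht)).differentiableAt two_ne_zero))
  simpa [Finset.sum_mul, mul_right_comm] using h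

theorem SymmetricOn.grad_sub_grad_mul_sub_nonpos (hs : SymmetricOn α f)
    (hf : ContDiffOn ℝ 2 f (Gam n α)) (hc : ConcaveOn ℝ (Gam n α) f) (hκ : κ ∈ Gam n α)
    (k l : Fin n) : (grad f κ k - grad f κ l) * (κ k - κ l) ≤ 0 :=
  CurvaturePinching.grad_sub_grad_mul_sub_nonpos hc hκ (comp_perm_mem_Gam hκ _) (hs κ hκ _)
    (hasFDerivAt_covector_grad ((hf.contDiffAt (Gam_mem_nhds hκ)).differentiableAt two_ne_zero))

/-! ### Inverse concavity -/

theorem inv_sub_mem_of_mem_Gam (hσα : σ ≤ α) (hκ : κ ∈ Gam n α) :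
    (fun i => (κ i - σ)⁻¹) ∈
      {y : Fin n → ℝ | (∀ i, 0 < y i) ∧ (fun i => σ + (y i)⁻¹) ∈ Gam n α} :=
  ⟨fun i => inv_pos.2 (sub_pos.2 (hσα.trans_lt (hκ i))), fun i => by simpa using hκ i⟩

theorem hasFDerivAt_neg_comp_inv {ι : Type*} [Fintype ι] [DecidableEq ι] {f : (ι → ℝ) → ℝ}
    {κ : ι → ℝ} (hf : DifferentiableAt ℝ f κ) (hκ : ∀ i, κ i - σ ≠ 0) :
    HasFDerivAt (fun y : ι → ℝ => -f (fun i => σ + (y i)⁻¹))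
      (covector fun k => grad f κ k * (κ k - σ) ^ 2) (fun i => (κ i - σ)⁻¹) := by
  set y : ι → ℝ := fun i => (κ i - σ)⁻¹ with hy
  have hinv : HasFDerivAt (fun y : ι → ℝ => fun i => σ + (y i)⁻¹)
      (ContinuousLinearMap.pi fun i => (-((y i) ^ 2)⁻¹) •
        ContinuousLinearMap.proj (R := ℝ) (φ := fun _ : ι => ℝ) i) y :=
    hasFDerivAt_pi.2 fun i => ((hasDerivAt_inv (inv_ne_zero (hκ i))).comp_hasFDerivAt y
      (hasFDerivAt_apply i y)).const_add σ
  have hgrad : HasFDerivAt f (covector (grad f κ)) (fun i => σ + (y i)⁻¹) := by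
    simpa [hy] using hasFDerivAt_covector_grad hf
  refine (hgrad.comp y hinv).neg.congr_fderiv ?_
  ext η
  simp only [neg_apply, ContinuousLinearMap.comp_apply, covector_apply,
    ContinuousLinearMap.pi_apply, smul_apply, ContinuousLinearMap.proj_apply, smul_eq_mul,
    ← Finset.sum_neg_distrib, hy, inv_pow, inv_inv]
  exact Finset.sum_congr rfl fun k _ => by ring

theorem InverseConcaveOn.hess_quadratic_nonneg (hi : InverseConcaveOn α σ f) (hσα : σ ≤ α)
    (hf : ContDiffOn ℝ 2 f (Gam n α)) (hκ : κ ∈ Gam n α) (η : Fin n → ℝ) :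
    0 ≤ ∑ k, ∑ l, hess f κ k l * η k * η l + 2 * ∑ k, grad f κ k * η k ^ 2 / (κ k - σ) := by
  have hpos : ∀ {x}, x ∈ Gam n α → ∀ i, x i - σ ≠ 0 := fun hx i =>
    (sub_pos.2 (hσα.trans_lt (hx i))).ne'
  have hline := hasDerivAt_add_smul κ η
  have hmem : ∀ᶠ t : ℝ in 𝓝 0, κ + t • η ∈ Gam n α :=
    hline.continuousAt.eventually_mem (by simpa using Gam_mem_nhds hκ)
  have hshift : ∀ i, HasDerivAt (fun t : ℝ => (κ + t • η) i - σ) (η i) 0 := fun i =>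
    ((hasDerivAt_pi.1 hline) i).sub_const σ
  have h := deriv_fderiv_apply_deriv_nonpos_of_concaveOn hi
    (hasDerivAt_pi.2 fun i => (hshift i).fun_inv (by simpa using hpos hκ i))
    (covector.hasFDerivAt.comp_hasDerivAt 0 (hasDerivAt_pi.2 fun i =>
      (hasDerivAt_grad_add_smul (hf.contDiffAt (Gam_mem_nhds hκ)) η i).mul
        ((hshift i).fun_pow 2)))
    (hmem.mono fun t ht => inv_sub_mem_of_mem_Gam hσα ht)
    (hmem.mono fun t ht => hasFDerivAt_neg_comp_inv
      ((hf.contDiffAt (Gam_mem_nhds ht)).differentiableAt two_ne_zero) (hpos ht))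
  rw [← neg_nonpos]
  refine h.trans_eq' ?_
  simp only [covector_apply, zero_smul, add_zero, Finset.mul_sum, ← Finset.sum_add_distrib,
    ← Finset.sum_neg_distrib]
  refine Finset.sum_congr rfl fun k _ => ?_
  have := hpos hκ k
  simp only [mul_right_comm _ (η k), ← Finset.sum_mul]
  field_simp
  ring

theorem InverseConcaveOn.sub_mul_grad_sub_grad_nonneg (hi : InverseConcaveOn α σ f) (hσα : σ ≤ α)
    (hs : SymmetricOn α f) (hf : ContDiffOn ℝ 2 f (Gam n α)) (hκ : κ ∈ Gam n α) (k l : Fin n) :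
    0 ≤ (κ k - κ l) * (grad f κ k * (κ k - σ) ^ 2 - grad f κ l * (κ l - σ) ^ 2) := by
  have hpos : ∀ i, 0 < κ i - σ := fun i => sub_pos.2 (hσα.trans_lt (hκ i))
  have h := CurvaturePinching.grad_sub_grad_mul_sub_nonpos hi (inv_sub_mem_of_mem_Gam hσα hκ)
    (inv_sub_mem_of_mem_Gam hσα (comp_perm_mem_Gam hκ (Equiv.swap k l)))
    (by simpa [Function.comp_def] using hs κ hκ (Equiv.swap k l))
    (hasFDerivAt_neg_comp_inv ((hf.contDiffAt (Gam_mem_nhds hκ)).differentiableAt two_ne_zero)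
      fun i => (hpos i).ne')
  have hkl := mul_pos (hpos k) (hpos l)
  refine nonneg_of_mul_nonneg_right (a := ((κ k - σ) * (κ l - σ))⁻¹) ?_ (inv_pos.2 hkl)
  refine (neg_nonneg.2 h).trans_eq ?_
  have hk := (hpos k).ne'
  have hl := (hpos l).ne'
  field_simp
  ring

end Symmetric

/-! ### The inequality in an eigenbasis -/

section Eigenbasis

variable {ι : Type*} [Fintype ι] {x p : ι → ℝ} {H c b : ι → ι → ℝ} {o : ι} {ε : ℝ}

/-- The quadratic form `∑ H_kl B_kk B_ll + ∑_{k ≠ l} c_kl B_kl²`. It is the second derivative of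
`F` in the direction `B`, in an eigenbasis, when `H` is the Hessian of `f` and `c_kl` are the
divided differences of its gradient. -/
def eigenQuad [DecidableEq ι] (H c B : ι → ι → ℝ) : ℝ :=
  ∑ k, ∑ l, H k l * B k k * B l l + ∑ k, ∑ l, if k = l then 0 else c k l * B k l ^ 2

/-- The expression under the supremum in an eigenbasis: `p` is the gradient of `f`, `z` the diagonal
of the quadratic part, `W` the linear part, and `g a k` is `Γᵃ_k`. -/
def eigenGamma (p z : ι → ℝ) (W g : ι → ι → ℝ) : ℝ :=
  ∑ k, p k * ∑ a, (2 * g a k * W a k - g a k ^ 2 * z a)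

/-- What concavity and inverse concavity of a symmetric function say about its derivatives at a
point `x` with positive components: `p` is the gradient, `H` the Hessian, and `c` consists of the
divided differences of the gradient. -/
structure ConcaveJet (x p : ι → ℝ) (H c : ι → ι → ℝ) : Prop where
  pos : ∀ k, 0 < x k
  coef_comm : ∀ k l, c k l = c l k
  coef_mul_sub : ∀ k l, c k l * (x k - x l) = p k - p l
  coef_nonpos : ∀ k l, c k l ≤ 0
  neg_le_coef : ∀ k l, k ≠ l → -(p k / x l + p l / x k) ≤ c k l
  quad_nonpos : ∀ η : ι → ℝ, ∑ k, ∑ l, H k l * η k * η l ≤ 0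
  quad_nonneg : ∀ η : ι → ℝ, 0 ≤ ∑ k, ∑ l, H k l * η k * η l + 2 * ∑ k, p k * η k ^ 2 / x k

namespace ConcaveJet

theorem coef_mul_sq (h : ConcaveJet x p H c) {a : ι} {r : ℝ} (hr : x a = x o → r = 0) :
    c o a * r ^ 2 = (p a - p o) * (r ^ 2 / (x a - x o)) := by
  by_cases ha : x a = x o
  · simp [hr ha]
  · have hne : x a - x o ≠ 0 := sub_ne_zero.2 ha
    have hmul := h.coef_mul_sub o a
    field_simp
    linear_combination -r ^ 2 * hmul

theorem sq_div_le_sq_div_sub (h : ConcaveJet x p H c) {a : ι} {r : ℝ} (hoa : x o ≤ x a)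
    (hr : x a = x o → r = 0) : r ^ 2 / x a ≤ r ^ 2 / (x a - x o) := by
  obtain ha | ha := hoa.eq_or_lt
  · simp [hr ha.symm]
  · exact div_le_div_of_nonneg_left (sq_nonneg r) (sub_pos.2 ha) (sub_le_self _ (h.pos o).le)

theorem grad_nonneg (h : ConcaveJet x p H c) (k : ι) : 0 ≤ p k := by
  classical
  have h1 := h.quad_nonpos (Pi.single k 1)
  have h2 := h.quad_nonneg (Pi.single k 1)
  simp only [Pi.single_apply, mul_ite, mul_one, mul_zero, Finset.sum_ite_eq', Finset.mem_univ,
    if_true, ite_pow, one_pow, ne_eq, OfNat.ofNat_ne_zero, not_false_eq_true, zero_pow, ite_div,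
    zero_div] at h1 h2
  exact nonneg_of_mul_nonneg_left (b := (x k)⁻¹) (by rw [← div_eq_mul_inv]; linarith)
    (inv_pos.2 (h.pos k))

theorem sub_const (h : ConcaveJet x p H c) {d : ℝ} (hd : 0 ≤ d) (hdx : ∀ k, d < x k) :
    ConcaveJet (fun k => x k - d) p H c := by
  have hle : ∀ {r : ℝ}, 0 ≤ r → ∀ k, r / x k ≤ r / (x k - d) := fun hr k =>
    div_le_div_of_nonneg_left hr (sub_pos.2 (hdx k)) (sub_le_self _ hd)
  refine ⟨fun k => sub_pos.2 (hdx k), h.coef_comm, fun k l => ?_, h.coef_nonpos,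
    fun k l hkl => (h.neg_le_coef k l hkl).trans' ?_, h.quad_nonpos,
    fun η => (h.quad_nonneg η).trans ?_⟩
  · rw [sub_sub_sub_cancel_right, h.coef_mul_sub]
  · linarith [hle (h.grad_nonneg k) l, hle (h.grad_nonneg l) k]
  · gcongr with k
    · exact mul_nonneg (h.grad_nonneg k) (sq_nonneg _)
    · exact sub_pos.2 (hdx k)
    · exact sub_le_self _ hd

theorem grad_eq_zero (h : ConcaveJet x p H c) {k : ι} (hk : p k = 0) : p = 0 := by
  funext l
  refine le_antisymm ?_ (h.grad_nonneg l)
  obtain hlk | hlk | hlk := lt_trichotomy (x k) (x l)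
  · have := h.coef_mul_sub k l
    have := mul_nonneg_of_nonpos_of_nonpos (h.coef_nonpos k l) (sub_nonpos.2 hlk.le)
    simp only [Pi.zero_apply]
    linarith
  · have := h.coef_mul_sub k l
    rw [hlk, sub_self, mul_zero] at this
    simp only [Pi.zero_apply]
    linarith
  · have hkl : k ≠ l := fun e => hlk.ne' (congrArg x e)
    have hmul := mul_le_mul_of_nonneg_right (h.neg_le_coef k l hkl) (sub_nonneg.2 hlk.le)
    rw [h.coef_mul_sub, hk, zero_div, zero_add, zero_sub, neg_mul, neg_le_neg_iff, mul_sub,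
      div_mul_cancel₀ _ (h.pos k).ne', le_sub_self_iff, div_mul_eq_mul_div,
      div_le_iff₀ (h.pos k), zero_mul] at hmul
    exact nonpos_of_mul_nonpos_left hmul (h.pos l)

variable [DecidableEq ι]

theorem eigenQuad_eq_zero (h : ConcaveJet x 0 H c) (B : ι → ι → ℝ) : eigenQuad H c B = 0 := by
  have hH : ∑ k, ∑ l, H k l * B k k * B l l = 0 :=
    le_antisymm (h.quad_nonpos fun k => B k k) (by simpa using h.quad_nonneg fun k => B k k)
  have hc : ∀ k l, k ≠ l → c k l = 0 := fun k l hkl =>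
    le_antisymm (h.coef_nonpos k l) (by simpa using h.neg_le_coef k l hkl)
  rw [eigenQuad, hH, zero_add]
  refine Finset.sum_eq_zero fun k _ => Finset.sum_eq_zero fun l _ => ?_
  split_ifs with hkl
  · rfl
  · rw [hc k l hkl, zero_mul]

theorem eigenQuad_le (h : ConcaveJet x p H c) {a : ι} (hoa : a ≠ o) {B : ι → ι → ℝ}
    (hB : B a o = B o a) : eigenQuad H c B ≤ 2 * (c o a * B o a ^ 2) := by
  set M : ι → ι → ℝ := fun k l => if k = l then 0 else c k l * B k l ^ 2 with hM
  have hM0 : ∀ k l, M k l ≤ 0 := fun k l => by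
    simp only [hM]
    split_ifs
    · exact le_rfl
    · exact mul_nonpos_of_nonpos_of_nonneg (h.coef_nonpos k l) (sq_nonneg _)
  have hrow : ∀ k l, ∑ j, M k j ≤ M k l := fun k l => by
    rw [← Finset.add_sum_erase _ _ (Finset.mem_univ l)]
    exact add_le_of_nonpos_right (Finset.sum_nonpos fun j _ => hM0 k j)
  have hrow0 : ∀ k, ∑ j, M k j ≤ 0 := fun k => Finset.sum_nonpos fun j _ => hM0 k j
  have hsum : ∑ k, ∑ l, M k l ≤ M o a + M a o := by
    rw [← Finset.add_sum_erase _ _ (Finset.mem_univ o),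
      ← Finset.add_sum_erase _ _ (Finset.mem_erase.2 ⟨hoa, Finset.mem_univ a⟩)]
    linarith [hrow o a, hrow a o,
      Finset.sum_nonpos fun k (_ : k ∈ (Finset.univ.erase o).erase a) => hrow0 k]
  have hMo : M o a + M a o = 2 * (c o a * B o a ^ 2) := by
    simp only [hM, if_neg hoa, if_neg hoa.symm, hB, h.coef_comm a o]
    ring
  have hdef : eigenQuad H c B = ∑ k, ∑ l, H k l * B k k * B l l + ∑ k, ∑ l, M k l := rfl
  linarith [h.quad_nonpos fun k => B k k]

theorem sum_sum_le_eigenQuad (h : ConcaveJet x p H c) (B : ι → ι → ℝ) :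
    ∑ k, ∑ l, (if k = l then -(2 * p k / x k) else c k l) * B k l ^ 2 ≤ eigenQuad H c B := by
  have hsplit : ∑ k, ∑ l, (if k = l then -(2 * p k / x k) else c k l) * B k l ^ 2 =
      -(2 * ∑ k, p k * B k k ^ 2 / x k) +
        ∑ k, ∑ l, if k = l then 0 else c k l * B k l ^ 2 := by
    have hdiag : ∀ k, -(2 * (p k * B k k ^ 2 / x k)) =
        ∑ l, if k = l then -(2 * (p k * B k k ^ 2 / x k)) else 0 := by simp
    rw [Finset.mul_sum, ← Finset.sum_neg_distrib, ← Finset.sum_add_distrib]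
    refine Finset.sum_congr rfl fun k _ => ?_
    rw [hdiag, ← Finset.sum_add_distrib]
    refine Finset.sum_congr rfl fun l _ => ?_
    split_ifs with hkl
    · subst hkl; ring
    · ring
  rw [hsplit, eigenQuad]
  linarith [h.quad_nonneg fun k => B k k]

theorem le_eigenQuad (h : ConcaveJet x p H c) (hb : ∀ k l, b k l = b l k) (o : ι) :
    -(2 * p o * b o o ^ 2 / x o) + 2 * ∑ l ∈ Finset.univ.erase o, c o l * b o l ^ 2
      - 2 * ∑ k ∈ Finset.univ.erase o, p k * ∑ l ∈ Finset.univ.erase o, b k l ^ 2 / x l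
      ≤ eigenQuad H c b := by
  refine (h.sum_sum_le_eigenQuad b).trans' ?_
  set M : ι → ι → ℝ := fun k l => (if k = l then -(2 * p k / x k) else c k l) * b k l ^ 2 with hM
  set s := Finset.univ.erase o
  have hsplit : ∀ φ : ι → ℝ, ∑ k, φ k = φ o + ∑ k ∈ s, φ k := fun φ =>
    (Finset.add_sum_erase _ _ (Finset.mem_univ o)).symm
  have hsymm : ∑ k ∈ s, ∑ l ∈ s, p l * (b k l ^ 2 / x k) =
      ∑ k ∈ s, ∑ l ∈ s, p k * (b k l ^ 2 / x l) := by
    rw [Finset.sum_comm]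
    exact Finset.sum_congr rfl fun k _ => Finset.sum_congr rfl fun l _ => by rw [hb]
  have hrest : ∑ k ∈ s, ∑ l ∈ s, -(p k * (b k l ^ 2 / x l) + p l * (b k l ^ 2 / x k)) ≤
      ∑ k ∈ s, ∑ l ∈ s, M k l := by
    refine Finset.sum_le_sum fun k _ => Finset.sum_le_sum fun l _ => ?_
    obtain rfl | hkl := eq_or_ne k l
    · refine le_of_eq ?_
      simp only [hM, if_true]
      ring
    · simp only [hM, if_neg hkl]
      refine (mul_le_mul_of_nonneg_right (h.neg_le_coef k l hkl) (sq_nonneg (b k l))).trans' ?_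
      exact le_of_eq (by ring)
  have hcross : ∀ l ∈ s, M o l + M l o = 2 * (c o l * b o l ^ 2) := fun l hl => by
    have hlo := Finset.ne_of_mem_erase hl
    simp only [hM, if_neg hlo, if_neg hlo.symm, hb l o, h.coef_comm l o]
    ring
  have hoo : M o o = -(2 * p o * b o o ^ 2 / x o) := by
    simp only [hM, if_true]
    ring
  have hcross' := Finset.sum_congr rfl hcross
  rw [Finset.sum_add_distrib, ← Finset.mul_sum] at hcross'
  simp only [Finset.sum_neg_distrib, Finset.sum_add_distrib] at hrest
  rw [hsymm] at hrest
  simp only [← Finset.mul_sum] at hrest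
  change _ ≤ ∑ k, ∑ l, M k l
  rw [hsplit fun k => ∑ l, M k l, hsplit (M o), Finset.sum_congr rfl fun k _ => hsplit (M k),
    Finset.sum_add_distrib]
  linarith

end ConcaveJet

theorem weighted_trace_le [DecidableEq ι] (hx : ∀ k, 0 < x k) (hε : ε * ∑ k, x k = x o)
    (hε0 : 0 ≤ ε) (hε1 : ε ≤ 1) {β : ι → ℝ} (hβ : β o = ε * ∑ k, β k) :
    (1 - ε) * (β o ^ 2 / x o) ≤ ε * ∑ a ∈ Finset.univ.erase o, β a ^ 2 / x a := by
  rw [← Finset.add_sum_erase _ _ (Finset.mem_univ o)] at hε hβ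
  set s := Finset.univ.erase o
  have hcauchy : (∑ a ∈ s, β a) ^ 2 ≤ (∑ a ∈ s, x a) * ∑ a ∈ s, β a ^ 2 / x a :=
    Finset.sum_sq_le_sum_mul_sum_of_sq_le_mul s (fun a _ => (hx a).le)
      (fun a _ => div_nonneg (sq_nonneg _) (hx a).le)
      fun a _ => (mul_div_cancel₀ _ (hx a).ne').ge
  obtain hlt | rfl := hε1.lt_or_eq
  · have h2 : (1 - ε) * β o = ε * ∑ a ∈ s, β a := by linarith
    have h3 : (1 - ε) * x o = ε * ∑ a ∈ s, x a := by linarith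
    rw [← mul_div_assoc, div_le_iff₀ (hx o)]
    refine le_of_mul_le_mul_left ?_ (sub_pos.2 hlt)
    calc (1 - ε) * ((1 - ε) * β o ^ 2) = ε ^ 2 * (∑ a ∈ s, β a) ^ 2 := by
          rw [← mul_pow, ← h2]; ring
      _ ≤ ε ^ 2 * ((∑ a ∈ s, x a) * ∑ a ∈ s, β a ^ 2 / x a) := by gcongr
      _ = ε * ((1 - ε) * x o) * ∑ a ∈ s, β a ^ 2 / x a := by rw [h3]; ring
      _ = (1 - ε) * (ε * (∑ a ∈ s, β a ^ 2 / x a) * x o) := by ring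
  · simpa using Finset.sum_nonneg fun a (_ : a ∈ s) => div_nonneg (sq_nonneg (β a)) (hx a).le

namespace ConcaveJet

variable [DecidableEq ι]

/-- The summand `p o * (b k k ^ 2 / x k)` is the share of the `k`-th diagonal entry in the `b_oo²`
term, which `weighted_trace_le` spreads over the diagonal. -/
theorem trace_term_nonneg (h : ConcaveJet x p H c) (ho : ∀ k, x o ≤ x k) (hε0 : 0 ≤ ε)
    (hε1 : ε ≤ 1) (hker : ∀ a ≠ o, x a = x o → ∀ k, b k a = 0) {k : ι} (hk : k ≠ o) :
    0 ≤ p k * ∑ l ∈ Finset.univ.erase o, b k l ^ 2 / (x l - x o)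
      - (1 - ε) * (p k * ∑ l ∈ Finset.univ.erase o, b k l ^ 2 / x l)
      - ε * ((p k - p o) * (b k k ^ 2 / (x k - x o)) + p o * (b k k ^ 2 / x k)) := by
  have hV : ∀ l, 0 ≤ b k l ^ 2 / x l := fun l => div_nonneg (sq_nonneg _) (h.pos l).le
  have hVF : ∀ l ∈ Finset.univ.erase o, b k l ^ 2 / x l ≤ b k l ^ 2 / (x l - x o) := fun l hl =>
    h.sq_div_le_sq_div_sub (ho l) fun hlo => hker l (Finset.ne_of_mem_erase hl) hlo k
  have hks : k ∈ Finset.univ.erase o := Finset.mem_erase.2 ⟨hk, Finset.mem_univ k⟩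
  have hrow := Finset.single_le_sum
    (f := fun l => b k l ^ 2 / (x l - x o) - (1 - ε) * (b k l ^ 2 / x l))
    (fun l hl => by linarith [hVF l hl, mul_nonneg hε0 (hV l)]) hks
  rw [Finset.sum_sub_distrib, ← Finset.mul_sum] at hrow
  have hmix : 0 ≤ (1 - ε) * p k + ε * p o :=
    add_nonneg (mul_nonneg (sub_nonneg.2 hε1) (h.grad_nonneg k)) (mul_nonneg hε0 (h.grad_nonneg o))
  linarith [mul_nonneg hmix (sub_nonneg.2 (hVF k hks)),
    mul_le_mul_of_nonneg_left hrow (h.grad_nonneg k)]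

theorem eigen_inequality (h : ConcaveJet x p H c) (hb : ∀ k l, b k l = b l k)
    (ho : ∀ k, x o ≤ x k) (hε : ε * ∑ k, x k = x o) (hε0 : 0 ≤ ε) (hε1 : ε ≤ 1)
    (hker : ∀ a ≠ o, x a = x o → ∀ k, b k a = 0) (htr : b o o = ε * ∑ k, b k k) :
    0 ≤ (1 - ε) * eigenQuad H c b - 2 * ε * ∑ a ∈ Finset.univ.erase o, c o a * b a a ^ 2
      + 2 * ∑ k, p k * ∑ a ∈ Finset.univ.erase o, b k a ^ 2 / (x a - x o) := by
  have hε1' : 0 ≤ 1 - ε := sub_nonneg.2 hε1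
  have hQ := mul_le_mul_of_nonneg_left (h.le_eigenQuad hb o) hε1'
  have hC := mul_le_mul_of_nonneg_left
    (weighted_trace_le h.pos hε hε0 hε1 (β := fun k => b k k) htr) (h.grad_nonneg o)
  have hdiag := Finset.sum_nonneg fun k (hk : k ∈ Finset.univ.erase o) =>
    h.trace_term_nonneg ho hε0 hε1 hker (Finset.ne_of_mem_erase hk)
  rw [← Finset.add_sum_erase _ _ (Finset.mem_univ o)]
  set s := Finset.univ.erase o
  have hzero : ∀ a ∈ s, ∀ k, x a = x o → b k a = 0 := fun a ha k hao =>
    hker a (Finset.ne_of_mem_erase ha) hao k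
  have hF : ∀ l, 0 ≤ b o l ^ 2 / (x l - x o) := fun l =>
    div_nonneg (sq_nonneg _) (sub_nonneg.2 (ho l))
  have hmixed := mul_nonneg hε1' (Finset.sum_nonneg fun l (_ : l ∈ s) =>
    mul_nonneg (h.grad_nonneg l) (hF l))
  have hmixed' := mul_nonneg hε0 (mul_nonneg (h.grad_nonneg o)
    (Finset.sum_nonneg fun l (_ : l ∈ s) => hF l))
  have hco : ∑ l ∈ s, c o l * b o l ^ 2 = ∑ l ∈ s, (p l - p o) * (b o l ^ 2 / (x l - x o)) :=
    Finset.sum_congr rfl fun l hl => h.coef_mul_sq (hzero l hl o)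
  have hca : ∑ a ∈ s, c o a * b a a ^ 2 = ∑ a ∈ s, (p a - p o) * (b a a ^ 2 / (x a - x o)) :=
    Finset.sum_congr rfl fun a ha => h.coef_mul_sq (hzero a ha a)
  rw [hco] at hQ
  rw [hca]
  simp only [sub_mul, Finset.sum_add_distrib, Finset.sum_sub_distrib, ← Finset.mul_sum]
    at hQ hdiag hmixed ⊢
  have hoo : 2 * p o * b o o ^ 2 / x o = 2 * (p o * (b o o ^ 2 / x o)) := by ring
  rw [hoo] at hQ
  linarith

end ConcaveJet

theorem eigenGamma_zero (p z : ι → ℝ) (W : ι → ι → ℝ) : eigenGamma p z W 0 = 0 := by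
  simp [eigenGamma]

theorem eigenGamma_div (p : ι → ℝ) {z : ι → ℝ} {W : ι → ι → ℝ} (hW : ∀ a k, z a = 0 → W a k = 0) :
    eigenGamma p z W (fun a k => W a k / z a) = ∑ k, p k * ∑ a, W a k ^ 2 / z a := by
  refine Finset.sum_congr rfl fun k _ => congrArg (p k * ·) (Finset.sum_congr rfl fun a _ => ?_)
  by_cases ha : z a = 0
  · simp [hW a k ha]
  · field_simp
    ring

theorem exists_eigenGamma_eq {z : ι → ℝ} {W : ι → ι → ℝ} {a k : ι} (hp : p k ≠ 0)
    (ha : z a = 0) (hW : W a k ≠ 0) (R : ℝ) : ∃ g, eigenGamma p z W g = R := by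
  classical
  refine ⟨fun i j => if i = a ∧ j = k then R / (2 * p k * W a k) else 0, ?_⟩
  rw [eigenGamma, Finset.sum_eq_single k, Finset.sum_eq_single a]
  · simp only [and_self, if_true, ha, mul_zero, sub_zero]
    field_simp
  · intro i _ hi; simp [hi]
  · simp
  · intro j _ hj; simp [hj]
  · simp

theorem ConcaveJet.exists_eigenGamma_nonneg [DecidableEq ι] (h : ConcaveJet x p H c)
    {T : ι → ι → ι → ℝ} (hT : ∀ i j k, T i j k = T j i k ∧ T i j k = T i k j)
    (ho : ∀ k, x o ≤ x k) (hε : ε * ∑ k, x k = x o) (hε0 : 0 ≤ ε) (hε1 : ε ≤ 1) :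
    ∃ g, 0 ≤ eigenQuad H c (T o) - ε * ∑ a, eigenQuad H c (T a)
      + 2 * eigenGamma p (fun a => x a - x o)
          (fun a k => T k a o - if a = o then ε * ∑ b, T k b b else 0) g := by
  set W : ι → ι → ℝ := fun a k => T k a o - if a = o then ε * ∑ b, T k b b else 0
  by_cases hp : ∃ k, p k = 0
  · obtain ⟨k, hk⟩ := hp
    obtain rfl := h.grad_eq_zero hk
    exact ⟨0, by simp [h.eigenQuad_eq_zero, eigenGamma_zero]⟩
  push Not at hp
  by_cases hW : ∀ a k, x a - x o = 0 → W a k = 0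
  swap
  · push Not at hW
    obtain ⟨a, k, ha, hne⟩ := hW
    obtain ⟨g, hg⟩ := exists_eigenGamma_eq (z := fun a => x a - x o) (hp k) ha hne
      (-(eigenQuad H c (T o) - ε * ∑ a, eigenQuad H c (T a)) / 2)
    exact ⟨g, by rw [hg]; linarith⟩
  have hTo : ∀ k a, T o k a = T k a o := fun k a => by rw [(hT o k a).1, (hT k o a).2]
  have hWne : ∀ {a}, a ≠ o → ∀ k, W a k = T o k a := fun ha k => by
    simp only [W, if_neg ha, sub_zero, hTo]
  have htr : ∀ k, T k o o = ε * ∑ b, T k b b := fun k =>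
    sub_eq_zero.1 (by simpa [W] using hW o k (sub_self _))
  have hmain := h.eigen_inequality (fun k l => (hT o k l).2) ho hε hε0 hε1
    (fun a ha hao k => by rw [← hWne ha, hW a k (sub_eq_zero.2 hao)]) (htr o)
  refine ⟨fun a k => W a k / (x a - x o), hmain.trans ?_⟩
  have hslices : ∑ a ∈ Finset.univ.erase o, eigenQuad H c (T a) ≤
      2 * ∑ a ∈ Finset.univ.erase o, c o a * T o a a ^ 2 := by
    rw [Finset.mul_sum]
    refine Finset.sum_le_sum fun a ha => ?_
    rw [(hT o a a).1]
    exact h.eigenQuad_le (Finset.ne_of_mem_erase ha) (hT a a o).2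
  have hgamma : ∀ k, ∑ a, W a k ^ 2 / (x a - x o) =
      ∑ a ∈ Finset.univ.erase o, T o k a ^ 2 / (x a - x o) := fun k => by
    rw [← Finset.add_sum_erase _ _ (Finset.mem_univ o), sub_self, div_zero, zero_add]
    exact Finset.sum_congr rfl fun a ha => by rw [hWne (Finset.ne_of_mem_erase ha)]
  rw [eigenGamma_div p hW, Finset.sum_congr rfl fun k _ => congrArg (p k * ·) (hgamma k),
    ← Finset.add_sum_erase _ (fun a => eigenQuad H c (T a)) (Finset.mem_univ o)]
  linarith [mul_le_mul_of_nonneg_left hslices hε0]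

end Eigenbasis

/-! ### Divided differences of the gradient -/

section DividedDifferences

variable {n : ℕ} {α σ : ℝ} {f : (Fin n → ℝ) → ℝ} {κ : Fin n → ℝ}

/-- The divided differences `(∂_k f - ∂_l f) / (κ_k - κ_l)` of the gradient. For `κ_k = κ_l` the
value is the limit of the quotient, for a symmetric function `f`. -/
def gradDivDiff (f : (Fin n → ℝ) → ℝ) (κ : Fin n → ℝ) (k l : Fin n) : ℝ :=
  if κ k = κ l then hess f κ k k - hess f κ k l
  else (grad f κ k - grad f κ l) / (κ k - κ l)

theorem sum_sum_mul_single_sub_single {ι : Type*} [Fintype ι] [DecidableEq ι] (M : ι → ι → ℝ)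
    (k l : ι) : ∑ i, ∑ j, M i j * (Pi.single k 1 - Pi.single l 1 : ι → ℝ) i *
      (Pi.single k 1 - Pi.single l 1 : ι → ℝ) j = M k k - M l k - (M k l - M l l) := by
  simp [mul_sub, Pi.single_apply, Finset.sum_sub_distrib]

theorem SymmetricOn.sum_hess_mul_single_sub_single (hs : SymmetricOn α f)
    (hf : ContDiffOn ℝ 2 f (Gam n α)) (hκ : κ ∈ Gam n α) {k l : Fin n} (h : κ k = κ l) :
    ∑ i, ∑ j, hess f κ i j * (Pi.single k 1 - Pi.single l 1 : Fin n → ℝ) i *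
      (Pi.single k 1 - Pi.single l 1 : Fin n → ℝ) j = 2 * gradDivDiff f κ k l := by
  rw [sum_sum_mul_single_sub_single, gradDivDiff, if_pos h, ← hs.hess_diag_eq_of_eq hκ h,
    hess_comm (hf.contDiffAt (Gam_mem_nhds hκ)) l k]
  ring

theorem SymmetricOn.gradDivDiff_comm (hs : SymmetricOn α f) (hf : ContDiffOn ℝ 2 f (Gam n α))
    (hκ : κ ∈ Gam n α) (k l : Fin n) : gradDivDiff f κ k l = gradDivDiff f κ l k := by
  unfold gradDivDiff
  by_cases h : κ k = κ l
  · rw [if_pos h, if_pos h.symm, hs.hess_diag_eq_of_eq hκ h,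
      hess_comm (hf.contDiffAt (Gam_mem_nhds hκ)) k l]
  · rw [if_neg h, if_neg (Ne.symm h), ← neg_sub (grad f κ l), ← neg_sub (κ l), neg_div_neg_eq]

theorem SymmetricOn.gradDivDiff_mul_sub (hs : SymmetricOn α f) (hκ : κ ∈ Gam n α) (k l : Fin n) :
    gradDivDiff f κ k l * (κ k - κ l) = grad f κ k - grad f κ l := by
  by_cases h : κ k = κ l
  · rw [h, sub_self, mul_zero, hs.grad_eq_of_eq hκ h, sub_self]
  · rw [gradDivDiff, if_neg h, div_mul_cancel₀ _ (sub_ne_zero.2 h)]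

theorem SymmetricOn.gradDivDiff_nonpos (hs : SymmetricOn α f) (hf : ContDiffOn ℝ 2 f (Gam n α))
    (hc : ConcaveOn ℝ (Gam n α) f) (hκ : κ ∈ Gam n α) (k l : Fin n) :
    gradDivDiff f κ k l ≤ 0 := by
  by_cases h : κ k = κ l
  · have hquad := hess_quadratic_nonpos hf hc hκ (Pi.single k 1 - Pi.single l 1)
    rw [hs.sum_hess_mul_single_sub_single hf hκ h] at hquad
    linarith
  · have hmul := hs.grad_sub_grad_mul_sub_nonpos hf hc hκ k l
    rw [← hs.gradDivDiff_mul_sub hκ, mul_assoc] at hmul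
    exact nonpos_of_mul_nonpos_left hmul (mul_self_pos.2 (sub_ne_zero.2 h))

theorem SymmetricOn.neg_le_gradDivDiff (hs : SymmetricOn α f) (hi : InverseConcaveOn α σ f)
    (hσα : σ ≤ α) (hf : ContDiffOn ℝ 2 f (Gam n α)) (hκ : κ ∈ Gam n α) {k l : Fin n}
    (hkl : k ≠ l) :
    -(grad f κ k / (κ l - σ) + grad f κ l / (κ k - σ)) ≤ gradDivDiff f κ k l := by
  have hpos : ∀ i, 0 < κ i - σ := fun i => sub_pos.2 (hσα.trans_lt (hκ i))
  have hk := hpos k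
  have hl := hpos l
  by_cases h : κ k = κ l
  · have hquad := hi.hess_quadratic_nonneg hσα hf hκ (Pi.single k 1 - Pi.single l 1)
    rw [hs.sum_hess_mul_single_sub_single hf hκ h, Finset.sum_eq_add k l hkl
      (fun i _ hi => by simp [hi.1, hi.2]) (by simp) (by simp)] at hquad
    simp only [Pi.sub_apply, Pi.single_eq_same, Pi.single_eq_of_ne hkl,
      Pi.single_eq_of_ne hkl.symm, sub_zero, zero_sub, neg_sq, one_pow, mul_one] at hquad
    rw [h] at hquad ⊢
    linarith
  · have hmul := hi.sub_mul_grad_sub_grad_nonneg hσα hs hf hκ k l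
    rw [gradDivDiff, if_neg h]
    have hsub := sub_ne_zero.2 h
    have hdiff : (grad f κ k - grad f κ l) / (κ k - κ l) +
        (grad f κ k / (κ l - σ) + grad f κ l / (κ k - σ)) =
        (κ k - κ l) * (grad f κ k * (κ k - σ) ^ 2 - grad f κ l * (κ l - σ) ^ 2) /
          ((κ k - κ l) ^ 2 * ((κ k - σ) * (κ l - σ))) := by
      field_simp
      ring
    rw [neg_le_iff_add_nonneg, hdiff]
    positivity

theorem SymmetricOn.concaveJet (hs : SymmetricOn α f) (hc : ConcaveOn ℝ (Gam n α) f)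
    (hi : InverseConcaveOn α σ f) (hσα : σ ≤ α) (hf : ContDiffOn ℝ 2 f (Gam n α))
    (hκ : κ ∈ Gam n α) :
    ConcaveJet (fun k => κ k - α) (grad f κ) (hess f κ) (gradDivDiff f κ) := by
  have hjet : ConcaveJet (fun k => κ k - σ) (grad f κ) (hess f κ) (gradDivDiff f κ) :=
    { pos := fun k => sub_pos.2 (hσα.trans_lt (hκ k))
      coef_comm := hs.gradDivDiff_comm hf hκ
      coef_mul_sub := fun k l => by rw [sub_sub_sub_cancel_right, hs.gradDivDiff_mul_sub hκ]
      coef_nonpos := hs.gradDivDiff_nonpos hf hc hκ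
      neg_le_coef := fun k l => hs.neg_le_gradDivDiff hi hσα hf hκ
      quad_nonpos := hess_quadratic_nonpos hf hc hκ
      quad_nonneg := hi.hess_quadratic_nonneg hσα hf hκ }
  have hshift := hjet.sub_const (sub_nonneg.2 hσα) fun k => sub_lt_sub_right (hκ k) σ
  simpa only [sub_sub_sub_cancel_right] using hshift

end DividedDifferences

/-! ### Spectral decompositions -/

section Spectral

variable {ι : Type*} [Fintype ι] [DecidableEq ι] {n : ℕ}

/-- A spectral decomposition of `X`: the columns of the orthogonal matrix `U` are eigenvectors of
`X`, with eigenvalues `l`. -/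
structure IsSpectral (X U : Matrix ι ι ℝ) (l : ι → ℝ) : Prop where
  orth : Uᵀ * U = 1
  eq : X = U * Matrix.diagonal l * Uᵀ

namespace IsSpectral

variable {X Y U : Matrix ι ι ℝ} {l m : ι → ℝ}

theorem orth' (h : IsSpectral X U l) : U * Uᵀ = 1 := mul_eq_one_comm.1 h.orth

theorem transpose_mul (h : IsSpectral X U l) : Uᵀ * X = Matrix.diagonal l * Uᵀ := by
  rw [h.eq, Matrix.mul_assoc, ← Matrix.mul_assoc, h.orth, Matrix.one_mul]

theorem mul_right (h : IsSpectral X U l) : X * U = U * Matrix.diagonal l := by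
  rw [h.eq, Matrix.mul_assoc, h.orth, Matrix.mul_one]

theorem comp_perm (h : IsSpectral X U l) (π : Equiv.Perm ι) :
    IsSpectral X (U.submatrix id π) (l ∘ π) := by
  have hd : Matrix.diagonal (l ∘ π) = (Matrix.diagonal l).submatrix π π :=
    (Matrix.submatrix_diagonal_equiv l π).symm
  constructor
  · rw [Matrix.transpose_submatrix, ← Matrix.submatrix_mul _ _ π id π Function.bijective_id,
      h.orth, Matrix.submatrix_one_equiv]
  · rw [Matrix.transpose_submatrix, hd, ← Matrix.submatrix_mul _ _ id π π π.bijective,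
      ← Matrix.submatrix_mul _ _ id π id π.bijective, ← h.eq, Matrix.submatrix_id_id]

theorem add (h : IsSpectral X U l) (h' : IsSpectral Y U m) : IsSpectral (X + Y) U (l + m) := by
  refine ⟨h.orth, ?_⟩
  rw [h.eq, h'.eq, ← Matrix.add_mul, ← Matrix.mul_add, Matrix.diagonal_add]
  rfl

theorem mul (h : IsSpectral X U l) (h' : IsSpectral Y U m) : IsSpectral (X * Y) U (l * m) := by
  refine ⟨h.orth, ?_⟩
  rw [h'.eq, ← Matrix.mul_assoc, ← Matrix.mul_assoc, h.mul_right, Matrix.mul_assoc U,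
    Matrix.diagonal_mul_diagonal]
  rfl

theorem aeval (h : IsSpectral X U l) (q : ℝ[X]) :
    IsSpectral (Polynomial.aeval X q) U fun i => q.eval (l i) := by
  induction q using Polynomial.induction_on with
  | C a =>
    refine ⟨h.orth, ?_⟩
    simp [← Matrix.smul_one_eq_diagonal, h.orth', Algebra.algebraMap_eq_smul_one]
  | add p q hp hq => simpa [Pi.add_def] using hp.add hq
  | monomial k a ih => simpa [pow_succ, ← mul_assoc, Pi.mul_def] using ih.mul h

theorem trace_eq (h : IsSpectral X U l) : X.trace = ∑ i, l i := by
  rw [h.eq, Matrix.trace_mul_comm, ← Matrix.mul_assoc, h.orth, Matrix.one_mul,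
    Matrix.trace_diagonal]

theorem trace_mul_eq (h : IsSpectral X U l) (B : Matrix ι ι ℝ) :
    (X * B).trace = ∑ i, l i * (Uᵀ * B * U) i i := by
  rw [h.eq, Matrix.mul_assoc, Matrix.mul_assoc, Matrix.trace_mul_comm, Matrix.mul_assoc]
  simp [Matrix.trace, Matrix.diagonal_mul]

end IsSpectral

theorem exists_isSpectral (A : SymMat n) :
    ∃ U, IsSpectral A.1 U (eig A) := by
  have hA := SymMat.isHermitian A
  refine ⟨hA.eigenvectorUnitary, ?_, ?_⟩
  · have := Unitary.coe_star_mul_self hA.eigenvectorUnitary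
    rwa [Matrix.star_eq_conjTranspose, Matrix.conjTranspose_eq_transpose_of_trivial] at this
  · have := hA.spectral_theorem
    rwa [Unitary.conjStarAlgAut_apply, Matrix.star_eq_conjTranspose,
      Matrix.conjTranspose_eq_transpose_of_trivial] at this

theorem sum_sq_col_eq_one {U : Matrix ι ι ℝ} (hU : Uᵀ * U = 1) (j : ι) :
    ∑ i, U i j ^ 2 = 1 := by
  simpa [Matrix.mul_apply, sq] using congrFun (congrFun hU j) j

theorem abs_entry_le_one {U : Matrix ι ι ℝ} (hU : Uᵀ * U = 1) (i j : ι) : |U i j| ≤ 1 := by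
  rw [← sq_le_one_iff_abs_le_one, ← sum_sq_col_eq_one hU j]
  exact Finset.single_le_sum (f := fun k => U k j ^ 2) (fun k _ => sq_nonneg _)
    (Finset.mem_univ i)

theorem abs_conj_diag_le {U : Matrix ι ι ℝ} (hU : Uᵀ * U = 1) (B : Matrix ι ι ℝ) (i : ι) :
    |(Uᵀ * B * U) i i| ≤ Fintype.card ι ^ 2 * ‖B‖ := by
  have hterm : ∀ j k, |U j i * B j k * U k i| ≤ ‖B‖ := fun j k => by
    rw [abs_mul, abs_mul]
    calc |U j i| * |B j k| * |U k i| ≤ 1 * ‖B‖ * 1 := by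
          gcongr
          · exact abs_entry_le_one hU j i
          · exact Matrix.norm_entry_le_entrywise_sup_norm B
          · exact abs_entry_le_one hU k i
      _ = ‖B‖ := by ring
  calc |(Uᵀ * B * U) i i| = |∑ k, ∑ j, U j i * B j k * U k i| := by
        simp [Matrix.mul_apply, Finset.sum_mul]
    _ ≤ ∑ k, ∑ j, |U j i * B j k * U k i| :=
        (Finset.abs_sum_le_sum_abs _ _).trans
          (Finset.sum_le_sum fun k _ => Finset.abs_sum_le_sum_abs _ _)
    _ ≤ ∑ _k : ι, ∑ _j : ι, ‖B‖ :=
        Finset.sum_le_sum fun k _ => Finset.sum_le_sum fun j _ => hterm j k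
    _ = Fintype.card ι ^ 2 * ‖B‖ := by
        simp only [Finset.sum_const, Finset.card_univ, nsmul_eq_mul]
        ring

/-! ### The Hoffman–Wielandt inequality -/

theorem sum_sq_eq_trace {ι : Type*} [Fintype ι] (M : Matrix ι ι ℝ) :
    ∑ i, ∑ j, M i j ^ 2 = (Mᵀ * M).trace := by
  rw [Finset.sum_comm]
  simp [Matrix.trace, Matrix.mul_apply, sq]

theorem sum_sq_conj {U V : Matrix ι ι ℝ} (hU : Uᵀ * U = 1) (hV : Vᵀ * V = 1)
    (M : Matrix ι ι ℝ) : ∑ i, ∑ j, (Uᵀ * M * V) i j ^ 2 = ∑ i, ∑ j, M i j ^ 2 := by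
  have h : (Uᵀ * M * V)ᵀ * (Uᵀ * M * V) = Vᵀ * (Mᵀ * (U * Uᵀ) * M * V) := by
    simp only [Matrix.transpose_mul, Matrix.transpose_transpose, Matrix.mul_assoc]
  rw [sum_sq_eq_trace, sum_sq_eq_trace, h, mul_eq_one_comm.1 hU, Matrix.mul_one,
    Matrix.trace_mul_comm, Matrix.mul_assoc, mul_eq_one_comm.1 hV, Matrix.mul_one]

theorem exists_perm_sum_le {M : Matrix ι ι ℝ} (hM : M ∈ doublyStochastic ℝ ι) (C : ι → ι → ℝ) :
    ∃ π : Equiv.Perm ι, ∑ i, C i (π i) ≤ ∑ i, ∑ j, M i j * C i j := by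
  let φ : Matrix ι ι ℝ →ₗ[ℝ] ℝ := ∑ i, ∑ j, C i j • Matrix.entryLinearMap ℝ ℝ i j
  have hφ : ∀ N, φ N = ∑ i, ∑ j, N i j * C i j := fun N => by
    simp [φ, LinearMap.sum_apply, mul_comm]
  rw [← SetLike.mem_coe, doublyStochastic_eq_convexHull_permMatrix] at hM
  obtain ⟨_, ⟨π, rfl⟩, hπ⟩ :=
    (φ.concaveOn convex_univ).exists_le_of_mem_convexHull (Set.subset_univ _) hM
  refine ⟨π, ?_⟩
  rw [hφ, hφ] at hπ
  simpa [Equiv.Perm.permMatrix, PEquiv.toMatrix_apply, Equiv.toPEquiv_apply] using hπ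

theorem sq_mem_doublyStochastic {W : Matrix ι ι ℝ} (hW : Wᵀ * W = 1) :
    Matrix.of (fun i j => W i j ^ 2) ∈ doublyStochastic ℝ ι := by
  refine mem_doublyStochastic_iff_sum.2 ⟨fun i j => sq_nonneg _, fun i => ?_,
    sum_sq_col_eq_one hW⟩
  exact sum_sq_col_eq_one (U := Wᵀ) (by simpa using mul_eq_one_comm.1 hW) i

theorem hoffman_wielandt {X Y U V : Matrix ι ι ℝ} {l m : ι → ℝ} (hX : IsSpectral X U l)
    (hY : IsSpectral Y V m) :
    ∃ π : Equiv.Perm ι, ∑ i, (m (π i) - l i) ^ 2 ≤ ∑ i, ∑ j, (Y - X) i j ^ 2 := by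
  have hW : (Uᵀ * V)ᵀ * (Uᵀ * V) = 1 := by
    rw [Matrix.transpose_mul, Matrix.transpose_transpose, Matrix.mul_assoc,
      ← Matrix.mul_assoc U, hX.orth', Matrix.one_mul, hY.orth]
  obtain ⟨π, hπ⟩ := exists_perm_sum_le (sq_mem_doublyStochastic hW) fun i j => (m j - l i) ^ 2
  have hentry : ∀ i j, (Uᵀ * (Y - X) * V) i j = (Uᵀ * V) i j * (m j - l i) := fun i j => by
    rw [Matrix.mul_sub, Matrix.sub_mul, hX.transpose_mul, Matrix.mul_assoc, hY.mul_right,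
      Matrix.mul_assoc, ← Matrix.mul_assoc, Matrix.sub_apply, Matrix.mul_diagonal,
      Matrix.diagonal_mul]
    ring
  refine ⟨π, hπ.trans_eq ?_⟩
  rw [← sum_sq_conj hX.orth hY.orth]
  simp only [hentry, mul_pow, Matrix.of_apply]

theorem IsSpectral.exists_perm_abs_sub_le {X Y U V : Matrix ι ι ℝ} {l m : ι → ℝ}
    (hX : IsSpectral X U l) (hY : IsSpectral Y V m) :
    ∃ π : Equiv.Perm ι, ∀ i, |m (π i) - l i| ≤ Fintype.card ι * ‖Y - X‖ := by
  obtain ⟨π, hπ⟩ := hoffman_wielandt hX hY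
  refine ⟨π, fun i => abs_le_of_sq_le_sq ?_ (by positivity)⟩
  have hentry : ∀ i j, (Y - X) i j ^ 2 ≤ ‖Y - X‖ ^ 2 := fun i j =>
    sq_le_sq.2 ((Matrix.norm_entry_le_entrywise_sup_norm (Y - X)).trans (le_abs_self _))
  calc (m (π i) - l i) ^ 2 ≤ ∑ j, (m (π j) - l j) ^ 2 :=
        Finset.single_le_sum (f := fun j => (m (π j) - l j) ^ 2) (fun _ _ => sq_nonneg _)
          (Finset.mem_univ i)
    _ ≤ ∑ i, ∑ j, (Y - X) i j ^ 2 := hπ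
    _ ≤ ∑ _i : ι, ∑ _j : ι, ‖Y - X‖ ^ 2 :=
        Finset.sum_le_sum fun i _ => Finset.sum_le_sum fun j _ => hentry i j
    _ = (Fintype.card ι * ‖Y - X‖) ^ 2 := by
        simp only [Finset.sum_const, Finset.card_univ, nsmul_eq_mul]
        ring

theorem IsSpectral.exists_perm_eq {X U V : Matrix ι ι ℝ} {l m : ι → ℝ}
    (hl : IsSpectral X U l) (hm : IsSpectral X V m) : ∃ π : Equiv.Perm ι, l = m ∘ π := by
  obtain ⟨π, hπ⟩ := hl.exists_perm_abs_sub_le hm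
  refine ⟨π, funext fun i => ?_⟩
  have := hπ i
  rw [sub_self, norm_zero, mul_zero] at this
  exact (sub_eq_zero.1 (abs_nonpos_iff.1 this)).symm

end Spectral

/-! ### Polynomials of a symmetric matrix -/

section PolynomialCalculus

variable {n : ℕ}

theorem exists_hermite (s : Finset ℝ) (a b : ℝ → ℝ) :
    ∃ q : ℝ[X], ∀ x ∈ s, q.eval x = a x ∧ q.derivative.eval x = b x := by
  have hinj : Set.InjOn (id : ℝ → ℝ) s := Function.injective_id.injOn
  let q₀ := Lagrange.interpolate s id a
  let N := Lagrange.nodal s (id : ℝ → ℝ)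
  let q₁ := Lagrange.interpolate s id
    fun x => (b x - q₀.derivative.eval x) / N.derivative.eval x
  refine ⟨q₀ + N * q₁, fun x hx => ?_⟩
  have h₀ : q₀.eval x = a x := Lagrange.eval_interpolate_at_node a hinj hx
  have h₁ : q₁.eval x = (b x - q₀.derivative.eval x) / N.derivative.eval x :=
    Lagrange.eval_interpolate_at_node _ hinj hx
  have hN : N.eval x = 0 := Lagrange.eval_nodal_at_node (v := (id : ℝ → ℝ)) hx
  have hN' : N.derivative.eval x ≠ 0 := by
    have := Lagrange.eval_nodal_derivative_eval_node_eq (v := (id : ℝ → ℝ)) hx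
    rw [id] at this
    rw [this]
    exact Lagrange.eval_nodal_not_at_node fun y hy => (Finset.ne_of_mem_erase hy).symm
  refine ⟨by simp [h₀, hN], ?_⟩
  simp only [derivative_add, derivative_mul, eval_add, eval_mul, hN, h₁]
  field_simp
  ring

/-- The divided difference of a polynomial, extended by the derivative to the diagonal. -/
def divDiff (q : ℝ[X]) (a b : ℝ) : ℝ :=
  if a = b then q.derivative.eval a else (q.eval a - q.eval b) / (a - b)

theorem divDiff_C (c a b : ℝ) : divDiff (C c) a b = 0 := by
  simp [divDiff]

theorem divDiff_add (p q : ℝ[X]) (a b : ℝ) :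
    divDiff (p + q) a b = divDiff p a b + divDiff q a b := by
  unfold divDiff
  split_ifs
  · simp
  · rw [eval_add, eval_add]
    ring

theorem divDiff_mul_X (q : ℝ[X]) (a b : ℝ) :
    divDiff (q * X) a b = q.eval a + divDiff q a b * b := by
  unfold divDiff
  split_ifs with h
  · subst h
    simp [add_comm]
  · have : a - b ≠ 0 := sub_ne_zero.2 h
    simp only [eval_mul, eval_X]
    field_simp
    ring

variable {A : SymMat n} {U : Matrix (Fin n) (Fin n) ℝ} {l : Fin n → ℝ}

theorem IsSpectral.exists_hasFDerivAt_aeval (h : IsSpectral A.1 U l) (q : ℝ[X]) :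
    ∃ L : SymMat n →L[ℝ] Matrix (Fin n) (Fin n) ℝ,
      HasFDerivAt (fun X : SymMat n => Polynomial.aeval X.1 q) L A ∧
      ∀ B k j, (Uᵀ * L B * U) k j =
        divDiff q (l k) (l j) * (Uᵀ * B.1 * U) k j := by
  induction q using Polynomial.induction_on with
  | C a =>
    refine ⟨0, ?_, fun B k j => by simp [divDiff_C]⟩
    simpa using hasFDerivAt_const (𝕜 := ℝ) (algebraMap ℝ (Matrix (Fin n) (Fin n) ℝ) a) A
  | add p q hp hq =>
    obtain ⟨L, hL, hL'⟩ := hp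
    obtain ⟨K, hK, hK'⟩ := hq
    refine ⟨L + K, ?_, fun B k j => ?_⟩
    · simp only [map_add]
      exact hL.fun_add hK
    · rw [add_apply, Matrix.mul_add, Matrix.add_mul, Matrix.add_apply, hL', hK', divDiff_add,
        add_mul]
  | monomial m a ih =>
    rw [pow_succ, ← mul_assoc]
    obtain ⟨L, hL, hL'⟩ := ih
    let q := C a * X ^ m
    have hmul := (LinearMap.mul ℝ (Matrix (Fin n) (Fin n) ℝ)).toContinuousBilinearMap
      |>.hasFDerivAt_of_bilinear hL (SymMat n).subtypeL.hasFDerivAt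
    refine ⟨_, hmul.congr_of_eventuallyEq (Eventually.of_forall fun Y => ?_), fun B k j => ?_⟩
    · simp only [map_mul, aeval_X]
      rfl
    · change (Uᵀ * (Polynomial.aeval A.1 q * B.1 + L B * A.1) * U) k j = _
      have hleft : Uᵀ * (Polynomial.aeval A.1 q * B.1) * U =
          Matrix.diagonal (fun i => q.eval (l i)) * (Uᵀ * B.1 * U) := by
        rw [← Matrix.mul_assoc Uᵀ, (h.aeval q).transpose_mul]
        simp only [Matrix.mul_assoc]
      have hright : Uᵀ * (L B * A.1) * U = Uᵀ * L B * U * Matrix.diagonal l := by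
        rw [← Matrix.mul_assoc, Matrix.mul_assoc _ _ U, h.mul_right, ← Matrix.mul_assoc]
      rw [Matrix.mul_add, Matrix.add_mul, hleft, hright, Matrix.add_apply, Matrix.diagonal_mul,
        Matrix.mul_diagonal, hL', divDiff_mul_X]
      ring

/-- The continuous linear map `N ↦ tr N`. -/
def traceL (n : ℕ) : Matrix (Fin n) (Fin n) ℝ →L[ℝ] ℝ :=
  LinearMap.toContinuousLinearMap (Matrix.traceLinearMap (Fin n) ℝ ℝ)

theorem traceL_apply (N : Matrix (Fin n) (Fin n) ℝ) : traceL n N = N.trace := rfl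

/-- The pairing `(N, B) ↦ tr (N B)` of a matrix with a symmetric matrix. -/
def traceForm (n : ℕ) : Matrix (Fin n) (Fin n) ℝ →L[ℝ] SymMat n →L[ℝ] ℝ :=
  (LinearMap.compl₁₂ ((LinearMap.mul ℝ (Matrix (Fin n) (Fin n) ℝ)).compr₂
    (Matrix.traceLinearMap (Fin n) ℝ ℝ)) LinearMap.id (SymMat n).subtype).toContinuousBilinearMap

theorem traceForm_apply (N : Matrix (Fin n) (Fin n) ℝ) (B : SymMat n) :
    traceForm n N B = (N * B.1).trace := rfl

theorem trace_eq_sum_conj_diag (hU : Uᵀ * U = 1) (N : Matrix (Fin n) (Fin n) ℝ) :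
    N.trace = ∑ k, (Uᵀ * N * U) k k := by
  change _ = (Uᵀ * N * U).trace
  rw [Matrix.trace_mul_comm, ← Matrix.mul_assoc, mul_eq_one_comm.1 hU, Matrix.one_mul]

theorem abs_traceForm_sub_le {N N' : Matrix (Fin n) (Fin n) ℝ} {m m' : Fin n → ℝ}
    (h : IsSpectral N U m) (h' : IsSpectral N' U m') (B : SymMat n) :
    |traceForm n N B - traceForm n N' B| ≤ n ^ 3 * ‖m - m'‖ * ‖B‖ := by
  rw [traceForm_apply, traceForm_apply, h.trace_mul_eq, h'.trace_mul_eq,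
    ← Finset.sum_sub_distrib]
  simp only [← sub_mul]
  calc |∑ i, (m i - m' i) * (Uᵀ * B.1 * U) i i| ≤ ∑ i, |m i - m' i| * |(Uᵀ * B.1 * U) i i| := by
        simp only [← abs_mul]
        exact Finset.abs_sum_le_sum_abs _ _
    _ ≤ ∑ _i : Fin n, ‖m - m'‖ * (n ^ 2 * ‖B‖) :=
        Finset.sum_le_sum fun i _ => mul_le_mul (norm_le_pi_norm (m - m') i)
          (by simpa using abs_conj_diag_le h.orth B.1 i)
          (abs_nonneg _) (norm_nonneg _)
    _ = n ^ 3 * ‖m - m'‖ * ‖B‖ := by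
        rw [Finset.sum_const, Finset.card_univ, Fintype.card_fin, nsmul_eq_mul]
        ring

end PolynomialCalculus

/-! ### Derivatives of functions of the eigenvalues -/

section SpectralDerivatives

theorem hasFDerivAt_of_norm_sub_sub_le_comp {E F W W' : Type*} [NormedAddCommGroup E]
    [NormedSpace ℝ E] [NormedAddCommGroup F] [NormedSpace ℝ F] [NormedAddCommGroup W]
    [NormedSpace ℝ W] [NormedAddCommGroup W'] [NormedSpace ℝ W'] {G M : E → W} {D : E →L[ℝ] W}
    {ψ : F → W'} {m : E → F} {A : E} {l : F} {C : ℝ} (hM : HasFDerivAt M D A)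
    (hψ : HasFDerivAt ψ (0 : F →L[ℝ] W') l) (hO : (fun X => m X - l) =O[𝓝 A] fun X => X - A)
    (hm : Tendsto m (𝓝 A) (𝓝 l))
    (h : ∀ᶠ X in 𝓝 A, ‖(G X - M X) - (G A - M A)‖ ≤ C * ‖ψ (m X) - ψ l‖) :
    HasFDerivAt G D A := by
  have hψm : (fun X => ψ (m X) - ψ l) =o[𝓝 A] fun X => X - A := by
    have := (hψ.isLittleO.comp_tendsto hm).trans_isBigO hO
    simpa [Function.comp_def] using this
  rw [hasFDerivAt_iff_isLittleO] at hM ⊢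
  refine (((IsBigO.of_bound C h).trans_isLittleO hψm).add hM).congr_left fun X => ?_
  abel

variable {n : ℕ} {α : ℝ} {f : (Fin n → ℝ) → ℝ} {A : SymMat n} {U : Matrix (Fin n) (Fin n) ℝ}
  {l : Fin n → ℝ}

namespace IsSpectral

theorem mem_Gam (h : IsSpectral A.1 U l) (hA : eig A ∈ Gam n α) :
    l ∈ Gam n α := by
  obtain ⟨V, hV⟩ := exists_isSpectral A
  obtain ⟨π, rfl⟩ := h.exists_perm_eq hV
  exact comp_perm_mem_Gam hA π

theorem matFun_eq (h : IsSpectral A.1 U l) (hs : SymmetricOn α f)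
    (hl : l ∈ Gam n α) : matFun f A = f l := by
  obtain ⟨V, hV⟩ := exists_isSpectral A
  obtain ⟨π, hπ⟩ := hV.exists_perm_eq h
  rw [matFun, hπ, hs l hl π]

theorem exists_selection (h : IsSpectral A.1 U l) :
    ∃ (V : SymMat n → Matrix (Fin n) (Fin n) ℝ) (m : SymMat n → Fin n → ℝ),
      (∀ X : SymMat n, IsSpectral X.1 (V X) (m X)) ∧
      ((fun X => m X - l) =O[𝓝 A] fun X => X - A) ∧ Tendsto m (𝓝 A) (𝓝 l) := by
  choose V hV using exists_isSpectral (n := n)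
  choose π hπ using fun X : SymMat n => h.exists_perm_abs_sub_le (hV X)
  have hO : (fun X => eig X ∘ π X - l) =O[𝓝 A] fun X => X - A := by
    refine IsBigO.of_bound n (Eventually.of_forall fun X => ?_)
    rw [pi_norm_le_iff_of_nonneg (by positivity)]
    simpa using hπ X
  refine ⟨_, _, fun X => (hV X).comp_perm (π X), hO, ?_⟩
  have hsub : Tendsto (fun X => X - A) (𝓝 A) (𝓝 0) := by
    simpa using (continuous_sub_right A).tendsto A
  simpa using (hO.trans_tendsto hsub).add_const l

theorem exists_hasFDerivAt_trace_aeval (h : IsSpectral A.1 U l) (q : ℝ[X]) :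
    ∃ L : SymMat n →L[ℝ] ℝ,
      HasFDerivAt (fun X : SymMat n => (Polynomial.aeval X.1 q).trace) L A ∧
      ∀ B : SymMat n, L B = ∑ k, q.derivative.eval (l k) * (Uᵀ * B.1 * U) k k := by
  obtain ⟨L, hL, hL'⟩ := h.exists_hasFDerivAt_aeval q
  refine ⟨(traceL n).comp L, (traceL n).hasFDerivAt.comp A hL, fun B => ?_⟩
  rw [ContinuousLinearMap.comp_apply, traceL_apply, trace_eq_sum_conj_diag h.orth]
  refine Finset.sum_congr rfl fun k _ => ?_
  rw [hL', divDiff, if_pos rfl]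

end IsSpectral

theorem hasFDerivAt_eval_apply (q : ℝ[X]) (l : Fin n → ℝ) (i : Fin n) :
    HasFDerivAt (fun x : Fin n → ℝ => q.eval (x i))
      (covector (Pi.single i (q.derivative.eval (l i)))) l := by
  refine (HasDerivAt.comp_hasFDerivAt (h₂ := fun y => q.eval y) l (q.hasDerivAt (l i))
    (hasFDerivAt_apply (𝕜 := ℝ) i l)).congr_fderiv (ContinuousLinearMap.ext fun η => ?_)
  simp [Pi.single_apply]

theorem exists_apply_eq_of_forall_eq {ι β : Type*} {l : ι → β} {p : ι → ℝ}
    (h : ∀ i j, l i = l j → p i = p j) : ∃ b : β → ℝ, ∀ i, b (l i) = p i :=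
  ⟨Function.extend l p 0, Function.FactorsThrough.extend_apply (fun i j => h i j) 0⟩

theorem SymmetricOn.hasFDerivAt_matFun (hs : SymmetricOn α f)
    (hf : ContDiffOn ℝ 2 f (Gam n α)) (h : IsSpectral A.1 U l)
    (hl : l ∈ Gam n α) :
    HasFDerivAt (matFun f) (traceForm n (U * Matrix.diagonal (grad f l) * Uᵀ)) A := by
  obtain ⟨b, hb⟩ := exists_apply_eq_of_forall_eq fun i j => hs.grad_eq_of_eq hl (i := i) (j := j)
  obtain ⟨q, hq⟩ := exists_hermite (Finset.univ.image l) 0 b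
  have hgrad : ∀ i, q.derivative.eval (l i) = grad f l i := fun i => by
    rw [(hq (l i) (Finset.mem_image_of_mem l (Finset.mem_univ i))).2, hb]
  obtain ⟨L, hL, hL'⟩ := h.exists_hasFDerivAt_trace_aeval q
  obtain ⟨V, m, hV, hO, hm⟩ := h.exists_selection
  have hψ : HasFDerivAt (fun x : Fin n → ℝ => f x - ∑ i, q.eval (x i))
      (0 : (Fin n → ℝ) →L[ℝ] ℝ) l := by
    have hfl := (hf.contDiffAt (Gam_mem_nhds hl)).differentiableAt two_ne_zero
    refine ((hasFDerivAt_covector_grad hfl).sub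
      (HasFDerivAt.fun_sum fun i _ => hasFDerivAt_eval_apply q l i)).congr_fderiv ?_
    ext η
    simp [sum_apply, hgrad, Pi.single_apply]
  have hLeq : L = traceForm n (U * Matrix.diagonal (grad f l) * Uᵀ) :=
    ContinuousLinearMap.ext fun B => by
      rw [hL', traceForm_apply, IsSpectral.trace_mul_eq ⟨h.orth, rfl⟩]
      simp only [hgrad]
  rw [← hLeq]
  refine hasFDerivAt_of_norm_sub_sub_le_comp (C := 1) hL hψ hO hm ?_
  filter_upwards [hm (Gam_mem_nhds hl)] with X hX
  rw [(hV X).matFun_eq hs hX, h.matFun_eq hs hl, ((hV X).aeval q).trace_eq, (h.aeval q).trace_eq,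
    one_mul]

end SpectralDerivatives

/-! ### The second derivative of `F` -/

section SecondDerivative

theorem hasFDerivAt_of_abs_apply_sub_le_comp {E F W W' : Type*} [NormedAddCommGroup E]
    [NormedSpace ℝ E] [NormedAddCommGroup F] [NormedSpace ℝ F] [NormedAddCommGroup W]
    [NormedSpace ℝ W] [NormedAddCommGroup W'] [NormedSpace ℝ W'] {G : E → E →L[ℝ] ℝ} {N : E → W}
    {L : E →L[ℝ] W} {Λ : W →L[ℝ] E →L[ℝ] ℝ} {ψ : F → W'} {m : E → F} {A : E} {l : F} {C : ℝ}
    (hC : 0 ≤ C) (hN : HasFDerivAt N L A) (hA : G A = Λ (N A))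
    (hψ : HasFDerivAt ψ (0 : F →L[ℝ] W') l) (hψl : ψ l = 0)
    (hO : (fun X => m X - l) =O[𝓝 A] fun X => X - A) (hm : Tendsto m (𝓝 A) (𝓝 l))
    (h : ∀ᶠ X in 𝓝 A, ∀ B, |G X B - Λ (N X) B| ≤ C * ‖ψ (m X)‖ * ‖B‖) :
    HasFDerivAt G (Λ.comp L) A := by
  refine hasFDerivAt_of_norm_sub_sub_le_comp (C := C) (Λ.hasFDerivAt.comp A hN) hψ hO hm
    (h.mono fun X hX => ?_)
  rw [hA, Function.comp_apply, Function.comp_apply, sub_self, sub_zero, hψl, sub_zero]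
  exact ContinuousLinearMap.opNorm_le_bound _ (by positivity) hX

variable {n : ℕ} {α : ℝ} {f : (Fin n → ℝ) → ℝ} {A : SymMat n} {U V : Matrix (Fin n) (Fin n) ℝ}
  {l x : Fin n → ℝ}

theorem exists_hasFDerivAt_add_sum_smul {E W κ : Type*} [NormedAddCommGroup E] [NormedSpace ℝ E]
    [NormedAddCommGroup W] [NormedSpace ℝ W] {s : Finset κ} {φ : E → W} {ρ : κ → E → ℝ}
    {χ : κ → E → W} {φ' : E →L[ℝ] W} {ρ' : κ → E →L[ℝ] ℝ} {χ' : κ → E →L[ℝ] W} {x : E}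
    (hφ : HasFDerivAt φ φ' x) (hρ : ∀ μ, HasFDerivAt (ρ μ) (ρ' μ) x)
    (hχ : ∀ μ, HasFDerivAt (χ μ) (χ' μ) x) (hρx : ∀ μ, ρ μ x = 0) :
    ∃ L : E →L[ℝ] W, HasFDerivAt (fun y => φ y + ∑ μ ∈ s, ρ μ y • χ μ y) L x ∧
      ∀ B, L B = φ' B + ∑ μ ∈ s, ρ' μ B • χ μ x :=
  ⟨_, hφ.fun_add (HasFDerivAt.fun_sum (u := s) fun μ _ => (hρ μ).fun_smul (hχ μ)), fun B => by
    simp [hρx]⟩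

/-- Polynomials for which `i ↦ q (x_i) + ∑ μ, (∑ j, c_μ (x_j)) * e_μ (x_i)` agrees with the
gradient of `f` to first order at `x = l`. Unlike the gradient itself, this field extends from the
eigenvalues to matrices without reference to eigenvectors, also where eigenvalues collide. -/
structure GradModel (f : (Fin n → ℝ) → ℝ) (l : Fin n → ℝ) where
  nodes : Finset ℝ
  q : ℝ[X]
  c : ℝ → ℝ[X]
  e : ℝ → ℝ[X]
  eval_q : ∀ i, q.eval (l i) = grad f l i
  eval_c : ∀ μ i, (c μ).eval (l i) = 0
  hess_eq : ∀ i j, hess f l i j =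
    ∑ μ ∈ nodes, (c μ).derivative.eval (l j) * (e μ).eval (l i) +
      if i = j then q.derivative.eval (l i) else 0

theorem SymmetricOn.exists_hess_factorization (hs : SymmetricOn α f)
    (hf : ContDiffOn ℝ 2 f (Gam n α)) (hl : l ∈ Gam n α) :
    ∃ (d : ℝ → ℝ) (g : ℝ → ℝ → ℝ),
      ∀ i j, hess f l i j = g (l i) (l j) + if i = j then d (l i) else 0 := by
  obtain ⟨g, hg⟩ := exists_apply_eq_of_forall_eq
    (l := fun ij : {ij : Fin n × Fin n // ij.1 ≠ ij.2} => (l ij.1.1, l ij.1.2))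
    (p := fun ij => hess f l ij.1.1 ij.1.2) fun ij ij' h =>
      hs.hess_offDiag_eq_of_eq hf hl (congrArg Prod.fst h) (congrArg Prod.snd h) ij.2 ij'.2
  obtain ⟨d, hd⟩ := exists_apply_eq_of_forall_eq (l := l)
    (p := fun i => hess f l i i - g (l i, l i)) fun i j h => by
      rw [hs.hess_diag_eq_of_eq hl h, h]
  refine ⟨d, fun a b => g (a, b), fun i j => ?_⟩
  by_cases hij : i = j
  · subst hij
    rw [if_pos rfl, hd, add_sub_cancel]
  · rw [if_neg hij, add_zero]
    exact (hg ⟨(i, j), hij⟩).symm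

theorem SymmetricOn.nonempty_gradModel (hs : SymmetricOn α f) (hf : ContDiffOn ℝ 2 f (Gam n α))
    (hl : l ∈ Gam n α) : Nonempty (GradModel f l) := by
  obtain ⟨d, g, hdg⟩ := hs.exists_hess_factorization hf hl
  obtain ⟨b, hb⟩ := exists_apply_eq_of_forall_eq fun i j => hs.grad_eq_of_eq hl (i := i) (j := j)
  have hmem : ∀ i, l i ∈ Finset.univ.image l := fun i =>
    Finset.mem_image_of_mem l (Finset.mem_univ i)
  obtain ⟨q, hq⟩ := exists_hermite (Finset.univ.image l) b d
  choose c hc using fun μ => exists_hermite (Finset.univ.image l) 0 fun y => g μ y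
  choose e he using fun μ => exists_hermite (Finset.univ.image l) (Pi.single μ 1) 0
  refine ⟨⟨Finset.univ.image l, q, c, e, fun i => ?_, fun μ i => (hc μ _ (hmem i)).1,
    fun i j => ?_⟩⟩
  · rw [(hq _ (hmem i)).1, hb]
  · have hsum : ∑ μ ∈ Finset.univ.image l, (c μ).derivative.eval (l j) * (e μ).eval (l i) =
        ∑ μ ∈ Finset.univ.image l, if l i = μ then g μ (l j) else 0 :=
      Finset.sum_congr rfl fun μ _ => by
        rw [(hc μ _ (hmem j)).2, (he μ _ (hmem i)).1, Pi.single_apply, mul_ite, mul_one, mul_zero]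
    rw [hsum, Finset.sum_ite_eq, if_pos (hmem i), (hq _ (hmem i)).2, hdg]

namespace GradModel

variable (M : GradModel f l)

/-- The polynomial whose values at `x_i` model the gradient of `f` at `x`. -/
def poly (x : Fin n → ℝ) : ℝ[X] :=
  M.q + ∑ μ ∈ M.nodes, C (∑ j, (M.c μ).eval (x j)) * M.e μ

/-- The model of the gradient of `F` at `X`. -/
def matrix (X : Matrix (Fin n) (Fin n) ℝ) : Matrix (Fin n) (Fin n) ℝ :=
  aeval X M.q + ∑ μ ∈ M.nodes, (aeval X (M.c μ)).trace • aeval X (M.e μ)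

theorem isSpectral_matrix {X : Matrix (Fin n) (Fin n) ℝ} (h : IsSpectral X V x) :
    IsSpectral (M.matrix X) V fun i => (M.poly x).eval (x i) := by
  have hX : M.matrix X = aeval X (M.poly x) := by
    simp only [matrix, poly, map_add, map_sum (aeval X), map_mul (aeval X), aeval_C,
      (h.aeval _).trace_eq, ← Algebra.smul_def]
  rw [hX]
  exact h.aeval _

theorem eval_poly (i : Fin n) : (M.poly l).eval (l i) = grad f l i := by
  simp [poly, M.eval_c, M.eval_q]

theorem hasFDerivAt_eval_poly (i : Fin n) :
    HasFDerivAt (fun x => (M.poly x).eval (x i)) (covector (hess f l i)) l := by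
  have h := (hasFDerivAt_eval_apply M.q l i).fun_add (HasFDerivAt.fun_sum (u := M.nodes) fun μ _ =>
    (HasFDerivAt.fun_sum (u := Finset.univ) fun j _ => hasFDerivAt_eval_apply (M.c μ) l j).fun_mul
      (hasFDerivAt_eval_apply (M.e μ) l i))
  simp only [poly, eval_add, eval_finsetSum, eval_mul, eval_C]
  refine h.congr_fderiv (ContinuousLinearMap.ext fun η => ?_)
  simp only [add_apply, sum_apply, smul_apply, covector_apply, M.eval_c, M.hess_eq,
    Finset.sum_const_zero, zero_smul, zero_add, smul_eq_mul, Pi.single_apply, ite_mul, zero_mul,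
    Finset.sum_ite_eq', Finset.sum_ite_eq, Finset.mem_univ, if_true, add_mul,
    Finset.sum_add_distrib, Finset.sum_mul, Finset.mul_sum]
  rw [add_comm, Finset.sum_comm]
  simp only [mul_comm, mul_left_comm]

theorem exists_hasFDerivAt_matrix (h : IsSpectral A.1 U l) :
    ∃ L : SymMat n →L[ℝ] Matrix (Fin n) (Fin n) ℝ,
      HasFDerivAt (fun X : SymMat n => M.matrix X.1) L A ∧
      ∀ B k j, (Uᵀ * L B * U) k j = divDiff M.q (l k) (l j) * (Uᵀ * B.1 * U) k j +
        ∑ μ ∈ M.nodes, (∑ i, (M.c μ).derivative.eval (l i) * (Uᵀ * B.1 * U) i i) *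
          Matrix.diagonal (fun i => (M.e μ).eval (l i)) k j := by
  obtain ⟨L, hL, hL'⟩ := h.exists_hasFDerivAt_aeval M.q
  choose K hK _ using fun μ => h.exists_hasFDerivAt_aeval (M.e μ)
  choose τ hτ hτ' using fun μ => h.exists_hasFDerivAt_trace_aeval (M.c μ)
  have htr : ∀ μ, (aeval A.1 (M.c μ)).trace = 0 := fun μ => by
    rw [(h.aeval _).trace_eq]
    exact Finset.sum_eq_zero fun i _ => M.eval_c μ i
  have hconj : ∀ μ, Uᵀ * aeval A.1 (M.e μ) * U = Matrix.diagonal fun i => (M.e μ).eval (l i) :=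
    fun μ => by rw [(h.aeval _).transpose_mul, Matrix.mul_assoc, h.orth, Matrix.mul_one]
  obtain ⟨D, hD, hD'⟩ : ∃ D : SymMat n →L[ℝ] Matrix (Fin n) (Fin n) ℝ,
      HasFDerivAt (fun X : SymMat n => M.matrix X.1) D A ∧
      ∀ B, D B = L B + ∑ μ ∈ M.nodes, τ μ B • aeval A.1 (M.e μ) :=
    exists_hasFDerivAt_add_sum_smul hL hτ hK htr
  refine ⟨D, hD, fun B k j => ?_⟩
  simp only [hD', Matrix.mul_add, Matrix.add_mul, Matrix.mul_sum, Matrix.sum_mul, Matrix.mul_smul,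
    Matrix.smul_mul, hconj, Matrix.add_apply, Matrix.sum_apply, Matrix.smul_apply, hL', hτ',
    smul_eq_mul]

theorem divDiff_q {k j : Fin n} (hkj : k ≠ j) :
    divDiff M.q (l k) (l j) = gradDivDiff f l k j := by
  unfold divDiff gradDivDiff
  split_ifs with h
  · rw [M.hess_eq, M.hess_eq, if_pos rfl, if_neg hkj, h, add_zero, add_sub_cancel_left]
  · rw [M.eval_q, M.eval_q]

theorem eigenQuad_eq (B : Matrix (Fin n) (Fin n) ℝ) :
    eigenQuad (hess f l) (gradDivDiff f l) B = ∑ k, ∑ j, (divDiff M.q (l k) (l j) * B k j +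
      ∑ μ ∈ M.nodes, (∑ i, (M.c μ).derivative.eval (l i) * B i i) *
          Matrix.diagonal (fun i => (M.e μ).eval (l i)) k j) * B k j := by
  have hdiag : ∀ k, ∑ j, hess f l k j * B k k * B j j =
      (∑ μ ∈ M.nodes, (∑ i, (M.c μ).derivative.eval (l i) * B i i) * (M.e μ).eval (l k)) * B k k +
        M.q.derivative.eval (l k) * B k k ^ 2 := fun k => by
    simp only [M.hess_eq, add_mul, Finset.sum_add_distrib, Finset.sum_mul, ite_mul, zero_mul,
      Finset.sum_ite_eq, Finset.mem_univ, if_true]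
    rw [Finset.sum_comm]
    congr 1
    · exact Finset.sum_congr rfl fun μ _ => Finset.sum_congr rfl fun i _ => by ring
    · ring
  have hself : ∀ k, divDiff M.q (l k) (l k) = M.q.derivative.eval (l k) := fun k => if_pos rfl
  have hoff : ∀ k, ∑ j, divDiff M.q (l k) (l j) * B k j * B k j =
      M.q.derivative.eval (l k) * B k k ^ 2 +
        ∑ j, if k = j then 0 else gradDivDiff f l k j * B k j ^ 2 := fun k => by
    rw [← Finset.add_sum_erase _ _ (Finset.mem_univ k), hself, mul_assoc, ← sq,
      ← Finset.add_sum_erase _ (fun j => if k = j then 0 else _) (Finset.mem_univ k), if_pos rfl,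
      zero_add]
    refine congrArg _ (Finset.sum_congr rfl fun j hj => ?_)
    have hkj := (Finset.ne_of_mem_erase hj).symm
    rw [if_neg hkj, M.divDiff_q hkj]
    ring
  have htrace : ∀ k, ∑ j, (∑ μ ∈ M.nodes, (∑ i, (M.c μ).derivative.eval (l i) * B i i) *
      Matrix.diagonal (fun i => (M.e μ).eval (l i)) k j) * B k j =
      (∑ μ ∈ M.nodes, (∑ i, (M.c μ).derivative.eval (l i) * B i i) * (M.e μ).eval (l k)) *
        B k k := fun k => by
    rw [Finset.sum_eq_single k (fun j _ hj => by simp [Matrix.diagonal_apply_ne _ hj.symm])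
      fun hk => absurd (Finset.mem_univ k) hk]
    simp only [Matrix.diagonal_apply_eq]
  simp only [eigenQuad, hdiag, add_mul, Finset.sum_add_distrib, hoff, htrace]
  ring

end GradModel

theorem SymmetricOn.hasFDerivAt_fderiv_matFun (hs : SymmetricOn α f)
    (hf : ContDiffOn ℝ 2 f (Gam n α)) (h : IsSpectral A.1 U l) (hl : l ∈ Gam n α)
    (M : GradModel f l) {L : SymMat n →L[ℝ] Matrix (Fin n) (Fin n) ℝ}
    (hL : HasFDerivAt (fun X : SymMat n => M.matrix X.1) L A) :
    HasFDerivAt (fun X : SymMat n => fderiv ℝ (matFun f) X) ((traceForm n).comp L) A := by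
  obtain ⟨V, m, hV, hO, hm⟩ := h.exists_selection
  have hψ : HasFDerivAt (fun x i => grad f x i - (M.poly x).eval (x i))
      (0 : (Fin n → ℝ) →L[ℝ] Fin n → ℝ) l :=
    hasFDerivAt_pi'.2 fun i => ((hasFDerivAt_grad (hf.contDiffAt (Gam_mem_nhds hl)) i).fun_sub
      (M.hasFDerivAt_eval_poly i)).congr_fderiv (by ext; simp)
  have hA : fderiv ℝ (matFun f) A = traceForm n (M.matrix A.1) := by
    rw [(hs.hasFDerivAt_matFun hf h hl).fderiv, (M.isSpectral_matrix h).eq]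
    simp only [M.eval_poly]
  refine hasFDerivAt_of_abs_apply_sub_le_comp (C := n ^ 3) (by positivity) hL hA hψ
    (by ext i; simp [M.eval_poly]) hO hm ?_
  filter_upwards [hm (Gam_mem_nhds hl)] with X hX B
  rw [(hs.hasFDerivAt_matFun hf (hV X) hX).fderiv]
  exact abs_traceForm_sub_le ⟨(hV X).orth, rfl⟩ (M.isSpectral_matrix (hV X)) B

theorem SymmetricOn.fderiv_fderiv_matFun_apply_self (hs : SymmetricOn α f)
    (hf : ContDiffOn ℝ 2 f (Gam n α)) (h : IsSpectral A.1 U l) (hl : l ∈ Gam n α) (B : SymMat n) :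
    fderiv ℝ (fun X : SymMat n => fderiv ℝ (matFun f) X) A B B =
      eigenQuad (hess f l) (gradDivDiff f l) (Uᵀ * B.1 * U) := by
  obtain ⟨M⟩ := hs.nonempty_gradModel hf hl
  obtain ⟨L, hL, hL'⟩ := M.exists_hasFDerivAt_matrix h
  have hB : B.1ᵀ = B.1 := B.2
  have hsymm : (Uᵀ * B.1 * U)ᵀ = Uᵀ * B.1 * U := by
    rw [Matrix.transpose_mul, Matrix.transpose_mul, hB, Matrix.transpose_transpose,
      Matrix.mul_assoc]
  have hmul : Uᵀ * (L B * B.1) * U = (Uᵀ * L B * U) * (Uᵀ * B.1 * U)ᵀ := by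
    rw [hsymm]
    simp only [Matrix.mul_assoc]
    rw [← Matrix.mul_assoc U Uᵀ, h.orth', Matrix.one_mul]
  rw [(hs.hasFDerivAt_fderiv_matFun hf h hl M hL).fderiv, ContinuousLinearMap.comp_apply,
    traceForm_apply, trace_eq_sum_conj_diag h.orth, hmul, M.eigenQuad_eq]
  refine Finset.sum_congr rfl fun k _ => ?_
  rw [Matrix.mul_apply]
  exact Finset.sum_congr rfl fun j _ => by rw [hL', Matrix.transpose_apply]

end SecondDerivative

/-! ### Eigenbases adapted to a smallest eigenvector -/

section AdaptedFrame

variable {n : ℕ} {α : ℝ} {A : SymMat n} {v : Fin n → ℝ} {X U V : Matrix (Fin n) (Fin n) ℝ}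
  {l m : Fin n → ℝ} {o : Fin n} {ρ μ : ℝ}

theorem IsSpectral.le_conj_diag (h : IsSpectral X V m) (hμ : ∀ i, μ ≤ m i) (hU : Uᵀ * U = 1)
    (i : Fin n) : μ ≤ (Uᵀ * X * U) i i := by
  have hVU : (Vᵀ * U)ᵀ * (Vᵀ * U) = 1 := by
    rw [Matrix.transpose_mul, Matrix.transpose_transpose, Matrix.mul_assoc, ← Matrix.mul_assoc V,
      h.orth', Matrix.one_mul, hU]
  have hconj : Uᵀ * X * U = (Vᵀ * U)ᵀ * (Matrix.diagonal m * (Vᵀ * U)) := by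
    rw [h.eq]
    simp only [Matrix.transpose_mul, Matrix.transpose_transpose, Matrix.mul_assoc]
  have hentry : (Uᵀ * X * U) i i = ∑ j, m j * (Vᵀ * U) j i ^ 2 := by
    rw [hconj, Matrix.mul_apply]
    refine Finset.sum_congr rfl fun j _ => ?_
    rw [Matrix.transpose_apply, Matrix.diagonal_mul]
    ring
  rw [hentry, ← mul_one μ, ← sum_sq_col_eq_one hVU i, Finset.mul_sum]
  exact Finset.sum_le_sum fun j _ => mul_le_mul_of_nonneg_right (hμ j) (sq_nonneg _)

theorem sum_sq_transpose_mulVec (hU : Uᵀ * U = 1) (v : Fin n → ℝ) :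
    ∑ i, (Uᵀ *ᵥ v) i ^ 2 = v ⬝ᵥ v := by
  have h : (Uᵀ *ᵥ v) ⬝ᵥ (Uᵀ *ᵥ v) = v ⬝ᵥ v := by
    rw [Matrix.dotProduct_mulVec, Matrix.vecMul_transpose, Matrix.mulVec_mulVec,
      mul_eq_one_comm.1 hU, Matrix.one_mulVec]
  simpa only [dotProduct, ← sq] using h

theorem eq_single_of_sum_sq_le {w : Fin n → ℝ} (h : ∑ i, w i ^ 2 ≤ w o ^ 2) :
    w = Pi.single o (w o) := by
  rw [← Finset.add_sum_erase _ _ (Finset.mem_univ o), add_le_iff_nonpos_right] at h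
  have h0 := (Finset.sum_eq_zero_iff_of_nonneg fun i _ => sq_nonneg (w i)).1
    (h.antisymm (Finset.sum_nonneg fun i _ => sq_nonneg _))
  refine funext fun i => ?_
  by_cases hi : i = o
  · rw [hi, Pi.single_eq_same]
  · rw [Pi.single_eq_of_ne hi]
    exact pow_eq_zero_iff two_ne_zero |>.1 (h0 i (Finset.mem_erase.2 ⟨hi, Finset.mem_univ i⟩))

/-- Subtracting `v vᵀ` makes the eigenvalue of `v` simple, so that `v` must be parallel to a column
of any eigenbasis. -/
theorem exists_isSpectral_sub_vecMulVec (hv : IsMinEigenvector A v) :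
    ∃ (U : Matrix (Fin n) (Fin n) ℝ) (m : Fin n → ℝ) (o : Fin n) (ρ : ℝ),
      IsSpectral (A.1 - Matrix.vecMulVec v v) U m ∧ ρ ≠ 0 ∧ v = ρ • U.col o := by
  obtain ⟨hv0, μ, hAv, hμ⟩ := hv
  have hA : A.1ᵀ = A.1 := A.2
  obtain ⟨U, hU⟩ := exists_isSpectral ⟨A.1 - Matrix.vecMulVec v v, show _ᵀ = _ by
    rw [Matrix.transpose_sub, hA, Matrix.transpose_vecMulVec]⟩
  generalize eig _ = m at hU
  obtain ⟨V, hV⟩ := exists_isSpectral A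
  obtain ⟨w, hw⟩ : ∃ w, Uᵀ *ᵥ v = w := ⟨_, rfl⟩
  have hvw : v = U *ᵥ w := by rw [← hw, Matrix.mulVec_mulVec, hU.orth', Matrix.one_mulVec]
  obtain ⟨o, ho⟩ : ∃ o, w o ≠ 0 := Function.ne_iff.1 fun hw0 => hv0 <| by
    rw [hvw, hw0]
    exact Matrix.mulVec_zero U
  have heig : m o * w o = (μ - v ⬝ᵥ v) * w o := by
    have h : Uᵀ *ᵥ ((A.1 - Matrix.vecMulVec v v) *ᵥ v) = Matrix.diagonal m *ᵥ w := by
      rw [Matrix.mulVec_mulVec, hU.transpose_mul, ← Matrix.mulVec_mulVec, hw]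
    have hv' : (A.1 - Matrix.vecMulVec v v) *ᵥ v = (μ - v ⬝ᵥ v) • v := by
      rw [Matrix.sub_mulVec, hAv, Matrix.vecMulVec_mulVec, sub_smul, op_smul_eq_smul]
    rw [hv', Matrix.mulVec_smul, hw] at h
    simpa [Matrix.mulVec_diagonal] using (congrFun h o).symm
  have hcol : (Uᵀ * A.1 * U) o o = m o + w o ^ 2 := by
    have h : Uᵀ * A.1 * U = Matrix.diagonal m + Matrix.vecMulVec w w := by
      rw [← sub_add_cancel A.1 (Matrix.vecMulVec v v), Matrix.mul_add, Matrix.add_mul,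
        hU.transpose_mul, Matrix.mul_assoc, hU.orth, Matrix.mul_one, Matrix.mul_vecMulVec,
        Matrix.vecMulVec_mul, ← Matrix.mulVec_transpose, hw]
    rw [h, Matrix.add_apply, Matrix.diagonal_apply_eq, Matrix.vecMulVec_apply, sq]
  have hle : ∑ i, w i ^ 2 ≤ w o ^ 2 := by
    have hray := hV.le_conj_diag hμ hU.orth o
    rw [hcol, mul_right_cancel₀ ho heig] at hray
    have hsum := sum_sq_transpose_mulVec hU.orth v
    rw [hw] at hsum
    linarith
  refine ⟨U, m, o, w o, hU, ho, ?_⟩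
  conv_lhs => rw [hvw, eq_single_of_sum_sq_le hle, Matrix.mulVec_single]
  rw [op_smul_eq_smul]

/-- The columns of `U` are an orthonormal eigenbasis of `A`, with eigenvalues `l`, in which `v` is
`ρ` times the basis vector `o`, and `l o` is the smallest eigenvalue. -/
structure IsAdaptedFrame (A : SymMat n) (v : Fin n → ℝ) (U : Matrix (Fin n) (Fin n) ℝ)
    (l : Fin n → ℝ) (o : Fin n) (ρ : ℝ) : Prop where
  spectral : IsSpectral A.1 U l
  ne_zero : ρ ≠ 0
  eq_smul_col : v = ρ • U.col o
  le : ∀ k, l o ≤ l k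

theorem IsSpectral.mulVec_col (h : IsSpectral X U l) (o : Fin n) :
    X *ᵥ U.col o = l o • U.col o := by
  rw [← Matrix.mulVec_single_one, Matrix.mulVec_mulVec, h.mul_right, ← Matrix.mulVec_mulVec,
    Matrix.diagonal_mulVec_single, mul_one, Matrix.mulVec_single, Matrix.mulVec_single_one,
    op_smul_eq_smul]

theorem isSpectral_vecMulVec_col (hU : Uᵀ * U = 1) (o : Fin n) (ρ : ℝ) :
    IsSpectral (Matrix.vecMulVec (ρ • U.col o) (ρ • U.col o)) U (Pi.single o (ρ ^ 2)) := by
  refine ⟨hU, Matrix.ext fun i j => ?_⟩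
  rw [Matrix.mul_apply, Finset.sum_eq_single o (fun k _ hk => by simp [hk])
    fun ho => absurd (Finset.mem_univ o) ho, Matrix.mul_diagonal, Pi.single_eq_same]
  simp only [Matrix.vecMulVec_apply, Pi.smul_apply, Matrix.col_apply, smul_eq_mul,
    Matrix.transpose_apply]
  ring

theorem exists_isAdaptedFrame (hv : IsMinEigenvector A v) :
    ∃ U l o ρ, IsAdaptedFrame A v U l o ρ := by
  obtain ⟨U, m, o, ρ, h, hρ, hvU⟩ := exists_isSpectral_sub_vecMulVec hv
  obtain ⟨hv0, μ, hAv, hμ⟩ := hv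
  have hA := h.add (isSpectral_vecMulVec_col h.orth o ρ)
  rw [← hvU, sub_add_cancel] at hA
  generalize m + Pi.single o (ρ ^ 2) = l at hA
  have ho : l o = μ := by
    have hv' : l o • v = μ • v := by
      rw [← hAv, hvU, Matrix.mulVec_smul, hA.mulVec_col, smul_comm]
    exact smul_left_injective ℝ hv0 hv'
  obtain ⟨V, hV⟩ := exists_isSpectral A
  obtain ⟨π, hπ⟩ := hA.exists_perm_eq hV
  refine ⟨U, l, o, ρ, hA, hρ, hvU, fun k => ?_⟩
  rw [ho, hπ]
  exact hμ (π k)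

end AdaptedFrame

/-! ### The pinching ratio -/

section PinchingRatio

variable {n : ℕ} {α : ℝ} {A : SymMat n} {v : Fin n → ℝ} {U : Matrix (Fin n) (Fin n) ℝ}
  {l : Fin n → ℝ} {o : Fin n} {ρ : ℝ}

theorem IsSpectral.shifted (h : IsSpectral A.1 U l) :
    IsSpectral (shifted α A) U fun k => l k - α := by
  refine ⟨h.orth, ?_⟩
  have hdiag : Matrix.diagonal (fun k => l k - α) =
      Matrix.diagonal l - α • (1 : Matrix (Fin n) (Fin n) ℝ) := by
    rw [Matrix.smul_one_eq_diagonal, Matrix.diagonal_sub]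
  rw [hdiag, Matrix.mul_sub, Matrix.sub_mul, ← h.eq, Matrix.mul_smul, Matrix.mul_one,
    Matrix.smul_mul, h.orth']
  rfl

theorem sum_sub_pos (o : Fin n) (hl : l ∈ Gam n α) : 0 < ∑ k, (l k - α) :=
  Finset.sum_pos (fun k _ => sub_pos.2 (hl k)) ⟨o, Finset.mem_univ o⟩

namespace IsAdaptedFrame

theorem sum_sq_eq (h : IsAdaptedFrame A v U l o ρ) : ∑ i, v i ^ 2 = ρ ^ 2 := by
  simp only [h.eq_smul_col, Pi.smul_apply, Matrix.col_apply, smul_eq_mul, mul_pow,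
    ← Finset.mul_sum, sum_sq_col_eq_one h.spectral.orth, mul_one]

theorem eps_eq (h : IsAdaptedFrame A v U l o ρ) :
    eps α A v = (l o - α) / ∑ k, (l k - α) := by
  have hs := h.spectral.shifted (α := α)
  have hmul : shifted α A *ᵥ v = (l o - α) • v := by
    rw [h.eq_smul_col, Matrix.mulVec_smul, hs.mulVec_col, smul_comm]
  have hquad : ∑ i, ∑ j, shifted α A i j * v i * v j = (l o - α) * ∑ i, v i ^ 2 := by
    rw [Finset.mul_sum]
    refine Finset.sum_congr rfl fun i _ => ?_
    have hi : ∑ j, shifted α A i j * v j = (l o - α) * v i := congrFun hmul i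
    rw [sq, ← mul_assoc, ← hi, Finset.sum_mul]
    exact Finset.sum_congr rfl fun j _ => mul_right_comm _ _ _
  rw [eps, hquad, hs.trace_eq, h.sum_sq_eq,
    mul_div_mul_right _ _ (pow_ne_zero 2 h.ne_zero)]

theorem eps_mul_sum (h : IsAdaptedFrame A v U l o ρ) (hl : l ∈ Gam n α) :
    eps α A v * ∑ k, (l k - α) = l o - α := by
  rw [h.eps_eq, div_mul_cancel₀ _ (sum_sub_pos o hl).ne']

theorem eps_pos (h : IsAdaptedFrame A v U l o ρ) (hl : l ∈ Gam n α) : 0 < eps α A v := by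
  rw [h.eps_eq]
  exact div_pos (sub_pos.2 (hl o)) (sum_sub_pos o hl)

theorem eps_le (h : IsAdaptedFrame A v U l o ρ) (hl : l ∈ Gam n α) : eps α A v ≤ 1 / n := by
  rw [h.eps_eq, div_le_div_iff₀ (sum_sub_pos o hl) (Nat.cast_pos.2 o.pos), one_mul, mul_comm]
  simpa using Finset.card_nsmul_le_sum Finset.univ (fun k => l k - α) (l o - α)
    fun k _ => sub_le_sub_right (h.le k) α

theorem exists_eq_smul_one (h : IsAdaptedFrame A v U l o ρ) (hl : l ∈ Gam n α)
    (hε : eps α A v = 1 / n) : ∃ c : ℝ, A.1 = c • (1 : Matrix (Fin n) (Fin n) ℝ) := by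
  have hn : (n : ℝ) ≠ 0 := (Nat.cast_pos.2 o.pos).ne'
  have hsum : ∑ k, (l k - l o) = 0 := by
    rw [h.eps_eq, div_eq_div_iff (sum_sub_pos o hl).ne' hn] at hε
    simp only [Finset.sum_sub_distrib, Finset.sum_const, Finset.card_univ, Fintype.card_fin,
      nsmul_eq_mul] at hε ⊢
    linarith
  rw [Finset.sum_eq_zero_iff_of_nonneg fun k _ => sub_nonneg.2 (h.le k)] at hsum
  have hconst : l = fun _ => l o := funext fun k => sub_eq_zero.1 (hsum k (Finset.mem_univ k))
  refine ⟨l o, ?_⟩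
  rw [h.spectral.eq, hconst, ← Matrix.smul_one_eq_diagonal, Matrix.mul_smul, Matrix.mul_one,
    Matrix.smul_mul, h.spectral.orth']

end IsAdaptedFrame

end PinchingRatio

/-! ### Contractions with the components of the derivatives -/

section Components

variable {n : ℕ} {α : ℝ} {f : (Fin n → ℝ) → ℝ} {A : SymMat n} {U : Matrix (Fin n) (Fin n) ℝ}
  {l : Fin n → ℝ}

theorem SymmetricOn.F1_eq (hs : SymmetricOn α f) (hf : ContDiffOn ℝ 2 f (Gam n α))
    (h : IsSpectral A.1 U l) (hl : l ∈ Gam n α) :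
    Matrix.of (F1 f A) = U * Matrix.diagonal (grad f l) * Uᵀ := by
  have hsymm : (U * Matrix.diagonal (grad f l) * Uᵀ)ᵀ = U * Matrix.diagonal (grad f l) * Uᵀ := by
    simp [Matrix.mul_assoc]
  ext i j
  rw [Matrix.of_apply, F1, (hs.hasFDerivAt_matFun hf h hl).fderiv, traceForm_apply]
  generalize U * Matrix.diagonal (grad f l) * Uᵀ = P at hsymm ⊢
  have hP : P j i = P i j := congrFun (congrFun hsymm i) j
  simp only [symUnit, Matrix.mul_smul, Matrix.mul_add, Matrix.trace_smul, Matrix.trace_add,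
    Matrix.trace_mul_single, hP, MulOpposite.op_one, one_smul, smul_eq_mul]
  ring

theorem sum_smul_symUnit (B : SymMat n) : ∑ k, ∑ j, B.1 k j • symUnit k j = B := by
  have hB : B.1ᵀ = B.1 := B.2
  ext a b
  simp only [AddSubmonoidClass.coe_finsetSum, Submodule.coe_smul, symUnit, Matrix.sum_apply,
    Matrix.smul_apply, Matrix.add_apply, Matrix.single_apply, smul_eq_mul, mul_add, mul_ite,
    mul_one, mul_zero, Finset.sum_add_distrib, ite_and]
  simp only [Finset.sum_ite_irrel, Finset.sum_ite_eq', Finset.sum_const_zero, Finset.mem_univ,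
    if_true]
  rw [← congrFun (congrFun hB a) b, Matrix.transpose_apply]
  ring

theorem sum_mul_apply_symUnit (D : SymMat n →L[ℝ] SymMat n →L[ℝ] ℝ) (B C : SymMat n) :
    ∑ k, ∑ l, ∑ p, ∑ q, D (symUnit k l) (symUnit p q) * B.1 k l * C.1 p q = D B C := by
  have hC : ∀ L : SymMat n →L[ℝ] ℝ, ∑ p, ∑ q, L (symUnit p q) * C.1 p q = L C := fun L => by
    conv_rhs => rw [← sum_smul_symUnit C]
    simp only [map_sum, map_smul, smul_eq_mul, mul_comm]
  have hB : ∑ k, ∑ l, B.1 k l * D (symUnit k l) C = D B C := by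
    conv_rhs => rw [← sum_smul_symUnit B]
    simp only [map_sum, map_smul, sum_apply, smul_apply,
      smul_eq_mul]
  rw [← hB]
  refine Finset.sum_congr rfl fun k _ => Finset.sum_congr rfl fun l _ => ?_
  simp only [← hC (D (symUnit k l)), Finset.mul_sum]
  refine Finset.sum_congr rfl fun p _ => Finset.sum_congr rfl fun q _ => ?_
  ring

theorem sum_F2_mul (f : (Fin n → ℝ) → ℝ) (A B C : SymMat n) :
    ∑ k, ∑ l, ∑ p, ∑ q, F2 f A k l p q * B.1 k l * C.1 p q =
      fderiv ℝ (fun X : SymMat n => fderiv ℝ (matFun f) X) A B C :=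
  sum_mul_apply_symUnit _ B C

end Components

/-! ### The tensor in an eigenbasis -/

section Rotation

variable {n : ℕ} {T : Fin n → Fin n → Fin n → ℝ} {U : Matrix (Fin n) (Fin n) ℝ}

/-- The components of the 3-tensor `T` in the basis of the columns of `U`. -/
def rotate (U : Matrix (Fin n) (Fin n) ℝ) (T : Fin n → Fin n → Fin n → ℝ) (a b c : Fin n) : ℝ :=
  ∑ i, ∑ j, ∑ k, U i a * U j b * U k c * T i j k

theorem TotallySymmetric.rotate (hT : TotallySymmetric T) (U : Matrix (Fin n) (Fin n) ℝ) :
    TotallySymmetric (rotate U T) := by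
  intro a b c
  constructor
  · rw [CurvaturePinching.rotate, Finset.sum_comm]
    refine Finset.sum_congr rfl fun i _ => Finset.sum_congr rfl fun j _ =>
      Finset.sum_congr rfl fun k _ => ?_
    rw [(hT j i k).1, mul_comm (U j a)]
  · refine Finset.sum_congr rfl fun i _ => ?_
    rw [Finset.sum_comm]
    refine Finset.sum_congr rfl fun j _ => Finset.sum_congr rfl fun k _ => ?_
    rw [(hT i k j).2, mul_right_comm (U i a)]

/-- The symmetric matrix `(T_ijk)_jk`. -/
def slice (hT : TotallySymmetric T) (i : Fin n) : SymMat n :=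
  ⟨Matrix.of (T i), Matrix.ext fun j k => (hT i k j).2⟩

theorem conj_sum_smul_slice (hT : TotallySymmetric T) (a : Fin n) :
    Uᵀ * (∑ i, U i a • slice hT i : SymMat n).1 * U = Matrix.of (rotate U T a) := by
  ext b c
  simp only [AddSubmonoidClass.coe_finsetSum, Submodule.coe_smul, slice, Matrix.mul_apply,
    Matrix.transpose_apply, Matrix.sum_apply, Matrix.smul_apply, Matrix.of_apply, smul_eq_mul,
    rotate, Finset.sum_mul, Finset.mul_sum]
  rw [Finset.sum_comm, Finset.sum_congr rfl fun j _ => Finset.sum_comm]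
  refine Finset.sum_congr rfl fun i _ => Finset.sum_congr rfl fun j _ =>
    Finset.sum_congr rfl fun k _ => ?_
  ring

theorem sum_rotate_diag (hU : Uᵀ * U = 1) (hT : TotallySymmetric T) (a : Fin n) :
    ∑ b, rotate U T a b b = ∑ i, U i a * ∑ j, T i j j := by
  have htrace := trace_eq_sum_conj_diag hU (∑ i, U i a • slice hT i : SymMat n).1
  rw [conj_sum_smul_slice] at htrace
  rw [show ∑ b, rotate U T a b b = _ from htrace.symm, AddSubmonoidClass.coe_finsetSum,
    Matrix.trace_sum]
  exact Finset.sum_congr rfl fun i _ => Matrix.trace_smul _ _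

end Rotation

section BilinearForm

variable {ι E : Type*} [Fintype ι] [NormedAddCommGroup E] [NormedSpace ℝ E]

theorem sum_mul_mul_bilin (D : E →L[ℝ] E →L[ℝ] ℝ) (v w : ι → ℝ) (S : ι → E) :
    ∑ i, ∑ j, v i * w j * D (S i) (S j) = D (∑ i, v i • S i) (∑ j, w j • S j) := by
  simp only [map_sum, map_smul, sum_apply, smul_apply, smul_eq_mul, Finset.mul_sum, mul_assoc]
  rw [Finset.sum_comm]
  exact Finset.sum_congr rfl fun j _ => Finset.sum_congr rfl fun i _ => mul_left_comm _ _ _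

theorem sum_bilin_orthogonal [DecidableEq ι] {U : Matrix ι ι ℝ} (hU : U * Uᵀ = 1)
    (D : E →L[ℝ] E →L[ℝ] ℝ) (S : ι → E) :
    ∑ a, D (∑ i, U i a • S i) (∑ i, U i a • S i) = ∑ i, D (S i) (S i) := by
  have hrow : ∀ i j, ∑ a, U i a * U j a = (1 : Matrix ι ι ℝ) i j := fun i j => by
    rw [← hU, Matrix.mul_apply]
    rfl
  simp only [← sum_mul_mul_bilin]
  rw [Finset.sum_comm]
  refine Finset.sum_congr rfl fun i _ => ?_
  rw [Finset.sum_comm]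
  simp only [← Finset.sum_mul, hrow, Matrix.one_apply, ite_mul, one_mul, zero_mul,
    Finset.sum_ite_eq, Finset.mem_univ, if_true]

end BilinearForm

section GammaForm

variable {ι : Type*} [Fintype ι]

theorem eigenGamma_mul (p z : ι → ℝ) (W g : ι → ι → ℝ) (r : ℝ) :
    eigenGamma p z (fun a k => r * W a k) (fun a k => r * g a k) = r ^ 2 * eigenGamma p z W g := by
  simp only [eigenGamma, Finset.mul_sum]
  refine Finset.sum_congr rfl fun k _ => Finset.sum_congr rfl fun a _ => ?_
  ring

theorem sum_mul_gamma_eq_trace (P W Z G : Matrix ι ι ℝ) :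
    ∑ k, ∑ l, P k l * (2 * ∑ p, G p k * W l p - ∑ p, ∑ q, G p k * G q l * Z p q) =
      (P * ((2 : ℝ) • (W * G) - Gᵀ * Zᵀ * G)).trace := by
  refine Finset.sum_congr rfl fun k _ => ?_
  rw [Matrix.diag_apply, Matrix.mul_apply]
  refine Finset.sum_congr rfl fun l _ => ?_
  simp only [Matrix.sub_apply, Matrix.smul_apply, Matrix.mul_apply, Matrix.transpose_apply,
    smul_eq_mul, Finset.sum_mul]
  refine congrArg _ (congrArg₂ _ (congrArg _ ?_) ?_)
  · exact Finset.sum_congr rfl fun p _ => mul_comm _ _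
  · refine Finset.sum_congr rfl fun p _ => Finset.sum_congr rfl fun q _ => ?_
    ring

theorem IsSpectral.transpose_eq [DecidableEq ι] {X U : Matrix ι ι ℝ} {l : ι → ℝ}
    (h : IsSpectral X U l) : Xᵀ = X := by
  rw [h.eq, Matrix.transpose_mul, Matrix.transpose_mul, Matrix.transpose_transpose,
    Matrix.diagonal_transpose, Matrix.mul_assoc]

theorem IsSpectral.trace_gamma_eq [DecidableEq ι] {P Z U : Matrix ι ι ℝ} {p z : ι → ℝ}
    (hP : IsSpectral P U p) (hZ : IsSpectral Z U z) (W g : Matrix ι ι ℝ) :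
    (P * ((2 : ℝ) • (W * (U * g * Uᵀ)) - (U * g * Uᵀ)ᵀ * Zᵀ * (U * g * Uᵀ))).trace =
      eigenGamma p z (fun a k => (Uᵀ * W * U) k a) (fun a k => g a k) := by
  have hlin : Uᵀ * (W * (U * g * Uᵀ)) * U = Uᵀ * W * U * g := by
    simp only [Matrix.mul_assoc, hP.orth, Matrix.mul_one]
  have hquad : Uᵀ * ((U * g * Uᵀ)ᵀ * Zᵀ * (U * g * Uᵀ)) * U =
      gᵀ * Matrix.diagonal z * g := by
    rw [hZ.transpose_eq, hZ.eq]
    simp only [Matrix.transpose_mul, Matrix.transpose_transpose, Matrix.mul_assoc, hP.orth,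
      Matrix.mul_one, Matrix.one_mul, ← Matrix.mul_assoc Uᵀ U]
  rw [hP.trace_mul_eq]
  refine Finset.sum_congr rfl fun k _ => ?_
  rw [Matrix.mul_sub, Matrix.sub_mul, Matrix.mul_smul, Matrix.smul_mul, hlin, hquad,
    Matrix.sub_apply, Matrix.smul_apply, Matrix.mul_apply, Matrix.mul_apply, smul_eq_mul,
    Finset.mul_sum, ← Finset.sum_sub_distrib]
  refine congrArg _ (Finset.sum_congr rfl fun a _ => ?_)
  rw [Matrix.mul_diagonal, Matrix.transpose_apply]
  ring

end GammaForm

/-! ### `β` in an eigenbasis -/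

section Beta

variable {n : ℕ} {α : ℝ} {f : (Fin n → ℝ) → ℝ} {A : SymMat n} {v : Fin n → ℝ}
  {U : Matrix (Fin n) (Fin n) ℝ} {l : Fin n → ℝ} {o : Fin n} {ρ : ℝ}
  {T : Fin n → Fin n → Fin n → ℝ}

theorem IsAdaptedFrame.shifted_sub (h : IsAdaptedFrame A v U l o ρ) (hl : l ∈ Gam n α) :
    IsSpectral (shifted α A - (eps α A v * (shifted α A).trace) • (1 : Matrix _ _ ℝ)) U
      fun a => (l a - α) - (l o - α) := by
  have hs := h.spectral.shifted (α := α)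
  refine ⟨hs.orth, ?_⟩
  rw [hs.trace_eq, h.eps_mul_sum hl, ← Matrix.diagonal_sub, ← Matrix.smul_one_eq_diagonal (l o - α),
    Matrix.mul_sub, Matrix.sub_mul, ← hs.eq, Matrix.mul_smul, Matrix.mul_one, Matrix.smul_mul,
    hs.orth']

/-- The matrix `T_lpi vⁱ - ε δ^{ab} T_lab v_p`, with row index `l` and column index `p`. -/
def gammaLinear (ε : ℝ) (v : Fin n → ℝ) (T : Fin n → Fin n → Fin n → ℝ) :
    Matrix (Fin n) (Fin n) ℝ :=
  Matrix.of fun l p => (∑ i, T l p i * v i) - ε * (∑ a, T l a a) * v p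

theorem gammaLinear_eq (hT : TotallySymmetric T) (ε : ℝ) (v : Fin n → ℝ) :
    gammaLinear ε v T = (∑ i, v i • slice hT i : SymMat n).1 -
      ε • Matrix.vecMulVec (fun l => ∑ a, T l a a) v := by
  ext l p
  simp only [gammaLinear, slice, AddSubmonoidClass.coe_finsetSum, Submodule.coe_smul,
    Matrix.sub_apply, Matrix.sum_apply, Matrix.smul_apply, Matrix.of_apply, Matrix.vecMulVec_apply,
    smul_eq_mul, mul_assoc]
  refine congrArg₂ _ (Finset.sum_congr rfl fun i _ => ?_) rfl
  rw [(hT l p i).2, (hT l i p).1, mul_comm]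

theorem conj_gammaLinear (hU : Uᵀ * U = 1) (hT : TotallySymmetric T) (ε : ℝ) (k a : Fin n) :
    (Uᵀ * gammaLinear ε (ρ • U.col o) T * U) k a =
      ρ * (rotate U T k a o - if a = o then ε * ∑ b, rotate U T k b b else 0) := by
  have hcol : U.col o ᵥ* U = Pi.single o 1 := by
    rw [← Matrix.mulVec_transpose, ← Matrix.mulVec_single_one, Matrix.mulVec_mulVec, hU,
      Matrix.one_mulVec]
  have hdiag : (Uᵀ *ᵥ fun l => ∑ b, T l b b) k = ∑ b, rotate U T k b b :=
    (sum_rotate_diag hU hT k).symm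
  have hsymm : rotate U T o k a = rotate U T k a o := by
    rw [(hT.rotate U o k a).1, (hT.rotate U k o a).2]
  have hslice : (∑ i, (ρ • U.col o) i • slice hT i : SymMat n) =
      ρ • ∑ i, U i o • slice hT i := by
    simp only [Finset.smul_sum, smul_smul, Pi.smul_apply, Matrix.col_apply, smul_eq_mul]
  rw [gammaLinear_eq hT, hslice, Submodule.coe_smul, Matrix.mul_sub, Matrix.sub_mul,
    Matrix.mul_smul, Matrix.smul_mul, conj_sum_smul_slice, Matrix.mul_smul, Matrix.smul_mul,
    Matrix.mul_vecMulVec, Matrix.vecMulVec_mul, Matrix.smul_vecMul, hcol]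
  simp only [Matrix.sub_apply, Matrix.smul_apply, Matrix.of_apply, Matrix.vecMulVec_apply, hdiag,
    hsymm, Pi.smul_apply, Pi.single_apply, smul_eq_mul]
  split_ifs <;> ring

theorem SymmetricOn.fderiv_fderiv_matFun_slice (hs : SymmetricOn α f)
    (hf : ContDiffOn ℝ 2 f (Gam n α)) (h : IsSpectral A.1 U l) (hl : l ∈ Gam n α)
    (hT : TotallySymmetric T) (a : Fin n) :
    fderiv ℝ (fun X : SymMat n => fderiv ℝ (matFun f) X) A (∑ i, U i a • slice hT i)
      (∑ i, U i a • slice hT i) = eigenQuad (hess f l) (gradDivDiff f l) (rotate U T a) := by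
  refine (hs.fderiv_fderiv_matFun_apply_self hf h hl _).trans ?_
  rw [conj_sum_smul_slice]
  rfl

theorem SymmetricOn.sum_F2_eq (hs : SymmetricOn α f) (hf : ContDiffOn ℝ 2 f (Gam n α))
    (h : IsSpectral A.1 U l) (hl : l ∈ Gam n α) (hT : TotallySymmetric T) :
    ∑ a, ∑ k, ∑ l, ∑ p, ∑ q, F2 f A k l p q * T a k l * T a p q =
      ∑ a, eigenQuad (hess f l) (gradDivDiff f l) (rotate U T a) := by
  refine (Finset.sum_congr rfl fun a _ => sum_F2_mul f A (slice hT a) (slice hT a)).trans ?_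
  refine (sum_bilin_orthogonal h.orth' _ (slice hT)).symm.trans ?_
  exact Finset.sum_congr rfl fun a _ => hs.fderiv_fderiv_matFun_slice hf h hl hT a

namespace IsAdaptedFrame

theorem gammaTerm_eq (h : IsAdaptedFrame A v U l o ρ) (hs : SymmetricOn α f)
    (hf : ContDiffOn ℝ 2 f (Gam n α)) (hl : l ∈ Gam n α) (hT : TotallySymmetric T)
    (g : Fin n → Fin n → ℝ) :
    gammaTerm α f A v T (fun p k => (U * Matrix.of (fun a k => ρ * g a k) * Uᵀ) p k) =
      ρ ^ 2 * eigenGamma (grad f l) (fun a => (l a - α) - (l o - α)) (fun a k =>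
        rotate U T k a o - if a = o then eps α A v * ∑ b, rotate U T k b b else 0) g := by
  have hP : IsSpectral (Matrix.of (F1 f A)) U (grad f l) :=
    ⟨h.spectral.orth, hs.F1_eq hf h.spectral hl⟩
  have htrace := (sum_mul_gamma_eq_trace _ (gammaLinear (eps α A v) v T) _ _).trans
    (hP.trace_gamma_eq (h.shifted_sub hl) _ (Matrix.of fun a k => ρ * g a k))
  rw [← eigenGamma_mul]
  refine htrace.trans ?_
  simp only [h.eq_smul_col, conj_gammaLinear h.spectral.orth hT, Matrix.of_apply]

theorem sum_mul_F2_eq (h : IsAdaptedFrame A v U l o ρ) (hs : SymmetricOn α f)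
    (hf : ContDiffOn ℝ 2 f (Gam n α)) (hl : l ∈ Gam n α) (hT : TotallySymmetric T) :
    ∑ i, ∑ j, ∑ k, ∑ l, ∑ p, ∑ q, v i * v j * F2 f A k l p q * T i k l * T j p q =
      ρ ^ 2 * eigenQuad (hess f l) (gradDivDiff f l) (rotate U T o) := by
  have hcontr : ∀ i j, ∑ k, ∑ l, ∑ p, ∑ q, v i * v j * F2 f A k l p q * T i k l * T j p q =
      ρ ^ 2 * (U i o * U j o * fderiv ℝ (fun X : SymMat n => fderiv ℝ (matFun f) X) A
        (slice hT i) (slice hT j)) := fun i j => by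
    rw [← sum_F2_mul]
    simp only [h.eq_smul_col, Pi.smul_apply, Matrix.col_apply, smul_eq_mul, Finset.mul_sum, slice,
      Matrix.of_apply]
    refine Finset.sum_congr rfl fun k _ => Finset.sum_congr rfl fun m _ =>
      Finset.sum_congr rfl fun p _ => Finset.sum_congr rfl fun q _ => ?_
    ring
  simp only [hcontr, ← Finset.mul_sum]
  exact congrArg _ ((sum_mul_mul_bilin _ _ _ (slice hT)).trans
    (hs.fderiv_fderiv_matFun_slice hf h.spectral hl hT o))

end IsAdaptedFrame

theorem beta_nonneg_of_exists (G : Fin n → Fin n → ℝ)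
    (hG : 0 ≤ (∑ i, ∑ j, ∑ k, ∑ l, ∑ p, ∑ q, v i * v j * F2 f A k l p q * T i k l * T j p q)
      - eps α A v * (∑ i, v i ^ 2) *
          (∑ a, ∑ k, ∑ l, ∑ p, ∑ q, F2 f A k l p q * T a k l * T a p q)
      + 2 * gammaTerm α f A v T G) :
    0 ≤ beta α f A v T := by
  have hsup : ((gammaTerm α f A v T G : ℝ) : EReal) ≤
      ⨆ G : Fin n → Fin n → ℝ, ((gammaTerm α f A v T G : ℝ) : EReal) :=
    le_iSup (fun G : Fin n → Fin n → ℝ => ((gammaTerm α f A v T G : ℝ) : EReal)) G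
  have hG' := EReal.coe_nonneg.2 hG
  rw [EReal.coe_add, EReal.coe_mul] at hG'
  exact hG'.trans (add_le_add le_rfl (mul_le_mul_of_nonneg_left hsup zero_le_two))

theorem IsAdaptedFrame.beta_nonneg {σ : ℝ} (h : IsAdaptedFrame A v U l o ρ)
    (hs : SymmetricOn α f) (hf : ContDiffOn ℝ 2 f (Gam n α)) (hc : ConcaveOn ℝ (Gam n α) f)
    (hi : InverseConcaveOn α σ f) (hσα : σ ≤ α) (hl : l ∈ Gam n α) (hT : TotallySymmetric T) :
    0 ≤ beta α f A v T := by
  have hε1 : eps α A v ≤ 1 := (h.eps_le hl).trans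
    (div_le_self zero_le_one (Nat.one_le_cast.2 o.pos))
  obtain ⟨g, hg⟩ := (hs.concaveJet hc hi hσα hf hl).exists_eigenGamma_nonneg (hT.rotate U)
    (fun k => sub_le_sub_right (h.le k) α) (h.eps_mul_sum hl) (h.eps_pos hl).le hε1
  refine beta_nonneg_of_exists (fun p k => (U * Matrix.of (fun a k => ρ * g a k) * Uᵀ) p k) ?_
  rw [h.sum_mul_F2_eq hs hf hl hT, hs.sum_F2_eq hf h.spectral hl hT, h.gammaTerm_eq hs hf hl hT g,
    h.sum_sq_eq]
  linarith [mul_nonneg (sq_nonneg ρ) hg]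

end Beta

end CurvaturePinching

end

theorem theorem4p3_general {n : ℕ} (α σ : ℝ) (hσα : σ ≤ α)
    (f : (Fin n → ℝ) → ℝ)
    (hf : ContDiffOn ℝ 2 f (CurvaturePinching.Gam n α))
    (hsymm : CurvaturePinching.SymmetricOn α f)
    (hconc : ConcaveOn ℝ (CurvaturePinching.Gam n α) f)
    (hinv : CurvaturePinching.InverseConcaveOn α σ f)
    (A : CurvaturePinching.SymMat n)
    (hA : CurvaturePinching.eig A ∈ CurvaturePinching.Gam n α)
    (v : Fin n → ℝ) (hv : CurvaturePinching.IsMinEigenvector A v)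
    (T : Fin n → Fin n → Fin n → ℝ) (hT : CurvaturePinching.TotallySymmetric T) :
    (0 < CurvaturePinching.eps α A v ∧ CurvaturePinching.eps α A v ≤ 1 / (n : ℝ) ∧
      (CurvaturePinching.eps α A v = 1 / (n : ℝ) →
        ∃ c : ℝ, (A : Matrix (Fin n) (Fin n) ℝ) = c • (1 : Matrix (Fin n) (Fin n) ℝ))) ∧
    0 ≤ CurvaturePinching.beta α f A v T := by
  obtain ⟨U, l, o, ρ, h⟩ := CurvaturePinching.exists_isAdaptedFrame hv
  have hl := h.spectral.mem_Gam hA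
  exact ⟨⟨h.eps_pos hl, h.eps_le hl, h.exists_eq_smul_one hl⟩,
    h.beta_nonneg hsymm hf hconc hinv hσα hl hT⟩

theorem theorem4p3 {n : ℕ} (α σ : ℝ) (hσ : 0 ≤ σ) (hσα : σ ≤ α)
    (f : (Fin n → ℝ) → ℝ)
    (hsmooth : ContDiffOn ℝ ∞ f (CurvaturePinching.Gam n α))
    (hsymm : CurvaturePinching.SymmetricOn α f)
    (hmono : MonotoneOn f (CurvaturePinching.Gam n α))
    (hconc : ConcaveOn ℝ (CurvaturePinching.Gam n α) f)
    (hinv : CurvaturePinching.InverseConcaveOn α σ f)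
    (A : CurvaturePinching.SymMat n)
    (hA : CurvaturePinching.eig A ∈ CurvaturePinching.Gam n α)
    (v : Fin n → ℝ) (hv : CurvaturePinching.IsMinEigenvector A v)
    (T : Fin n → Fin n → Fin n → ℝ) (hT : CurvaturePinching.TotallySymmetric T)
    (hTv : ∀ k, ∑ i, ∑ j, T i j k * v i * v j
      = CurvaturePinching.eps α A v * ∑ i, T i i k) :
    (0 < CurvaturePinching.eps α A v ∧ CurvaturePinching.eps α A v ≤ 1 / (n : ℝ) ∧
      (CurvaturePinching.eps α A v = 1 / (n : ℝ) →
        ∃ c : ℝ, (A : Matrix (Fin n) (Fin n) ℝ) = c • (1 : Matrix (Fin n) (Fin n) ℝ))) ∧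
    0 ≤ CurvaturePinching.beta α f A v T := by
  exact theorem4p3_general α σ hσα f (hsmooth.of_le (by norm_cast)) hsymm hconc hinv A hA v hv T hT
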